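/- Setting. Let $d\ge 1$ and let $\mu>0$, $L$, $\tilde L$, $\rho$ be real numbers with $0<\rho<1-\frac{\mu}{dL}$; put $M:=\tilde L/\mu^{3/2}$. On $\mathbb R^d$ use the Euclidean inner product and norm, and for matrices the spectral norm and $\langle X,Y\rangle=\operatorname{Tr}(X^{\mathsf T}Y)$. For $f_1,\dots,f_n:\mathbb R^d\to\mathbb R$ ($n\ge1$) twice continuously differentiable, consider the assumptions, for all $x,y\in\mathbb R^d$ and all $i$: $$\tfrac{\mu}{2}\|y-x\|^2\le f_i(y)-f_i(x)-\langle\nabla f_i(x),y-x\rangle\le\tfrac L2\|y-x\|^2,\qquad \|\nabla^2f_i(y)-\nabla^2f_i(x)\|\le\tilde L\|y-x\|.\tag{A}$$ Let $x^\star$ be the minimizer of $\frac1n\sum_{i=1}^nf_i$. Write $\|y\|_{f,x}:=\sqrt{\langle y,\nabla^2f(x)y\rangle}$, $\sigma(B,K):=\langle K^{-1},B-K\rangle$, and $$\mathrm{BFGS}(B,K,u):=B-\frac{Buu^{\mathsf T}B}{\langle u,Bu\rangle}+\frac{Kuu^{\mathsf T}K}{\langle u,Ku\rangle}\ (u\ne0),\qquad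 \mathrm{BFGS}(B,K,0):=B.$$ A greedy vector $\bar u(B,K)$ is any maximizer of $\langle u,Bu\rangle/\langle u,Ku\rangle$ over the standard basis vectors $u\in\{e_1,\dots,e_d\}$ (ties are broken arbitrarily). SIQN. Start from $x^0\in\mathbb R^d$, $z_i^0=x^0$, and symmetric matrices $B_i^0\succeq\nabla^2f_i(x^0)$, $i=1,\dots,n$. For $t\ge1$ let $i_t=1+((t-1)\bmod n)$ and $$x^t=\Big(\sum_{i=1}^nB_i^{t-1}\Big)^{-1}\sum_{i=1}^n\big(B_i^{t-1}z_i^{t-1}-\nabla f_i(z_i^{t-1})\big).$$ Set $z_j^t=z_j^{t-1}$ and $B_j^t=B_j^{t-1}$ for $j\neq i_t$, and, writing $i=i_t$, set $z_i^t=x^t$ and $$\beta_t=\tfrac M2\|z_i^t-z_i^{t-1}\|_{f_i,z_i^{t-1}},\qquad K^t=\int_0^1\nabla^2f_i\big(z_i^{t-1}+\tau(z_i^t-z_i^{t-1})\big)\,d\tau,$$ $$Q^t=\mathrm{BFGS}\big((1+\beta_t)^2B_i^{t-1},(1+\beta_t)K^t,z_i^t-z_i^{t-1}\big),\qquad B_i^t=\mathrm{BFGS}\big(Q^t,\nabla^2f_i(z_i^t),\bar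 u(Q^t,\nabla^2f_i(z_i^t))\big).$$ Lemma (linear convergence of SIQN). There exist constants $\epsilon>0$ and $\sigma_0>0$, depending only on $d,\mu,L,\tilde L,\rho$, such that for every $n\ge1$, all $f_1,\dots,f_n$ satisfying (A), and every run of SIQN with $$\|x^0-x^\star\|\le\epsilon\quad\text{and}\quad\sigma(B_i^0,\nabla^2f_i(x^0))\le\sigma_0\ \text{ for all }i,$$ we have $$\|x^t-x^\star\|\le\rho^{\lceil t/n\rceil}\|x^0-x^\star\|\quad\text{for all }t\ge0,$$ and, for all $t\ge1$, $$\sigma\big(B_{i_t}^t,\nabla^2f_{i_t}(z_{i_t}^t)\big)\le\Big(1-\frac{\mu}{dL}\Big)^{\lceil t/n\rceil}\delta,\qquad \delta:=e^{\frac{4M\sqrt L\,\epsilon}{1-\rho}}\Bigg(\sigma_0+\epsilon\,\frac{4Md\sqrt L}{1-\frac{\rho}{1-\frac{\mu}{dL}}}\Bigg).$$ -/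

import Mathlib

open scoped Matrix

noncomputable section

namespace SIQN

/-- The space `ℝ^d` with the Euclidean norm. -/
abbrev Vec (d : ℕ) : Type := EuclideanSpace ℝ (Fin d)

/-- Real `d × d` matrices. -/
abbrev Mat (d : ℕ) : Type := Matrix (Fin d) (Fin d) ℝ

/-- The spectral norm of a matrix: its operator norm with respect to the Euclidean norm. -/
def specNorm {d : ℕ} (A : Mat d) : ℝ :=
  ‖Matrix.toEuclideanCLM (n := Fin d) (𝕜 := ℝ) A‖

/-- The Hessian matrix of `f` at `x`; its `(i, j)` entry is `∂ᵢ ∂ⱼ f (x)`. -/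
def hess {d : ℕ} (f : Vec d → ℝ) (x : Vec d) : Mat d :=
  Matrix.of fun i j =>
    fderiv ℝ (fun y => fderiv ℝ f y) x (EuclideanSpace.single i 1) (EuclideanSpace.single j 1)

/-- The averaged Hessian `∫₀¹ ∇²f (x + τ (y - x)) dτ`, entrywise. -/
def avgHess {d : ℕ} (f : Vec d → ℝ) (x y : Vec d) : Mat d :=
  Matrix.of fun i j => ∫ τ in (0 : ℝ)..1, hess f (x + τ • (y - x)) i j

/-- `μ`-strong convexity of a differentiable function. -/
def StronglyConvex {d : ℕ} (μ : ℝ) (f : Vec d → ℝ) : Prop :=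
  ∀ x y : Vec d, μ / 2 * ‖y - x‖ ^ 2 ≤ f y - f x - inner ℝ (gradient f x) (y - x)

/-- `L`-smoothness of a differentiable function. -/
def Smooth {d : ℕ} (L : ℝ) (f : Vec d → ℝ) : Prop :=
  ∀ x y : Vec d, f y - f x - inner ℝ (gradient f x) (y - x) ≤ L / 2 * ‖y - x‖ ^ 2

/-- The Hessian of `f` is Lipschitz continuous with constant `Lt` in the spectral norm. -/
def HessLipschitz {d : ℕ} (Lt : ℝ) (f : Vec d → ℝ) : Prop :=
  ∀ x y : Vec d, specNorm (hess f y - hess f x) ≤ Lt * ‖y - x‖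

/-- The local norm `‖y‖_x = √⟨y, ∇²f(x) y⟩`. -/
def localNorm {d : ℕ} (f : Vec d → ℝ) (x y : Vec d) : ℝ :=
  Real.sqrt (y.ofLp ⬝ᵥ (hess f x *ᵥ y.ofLp))

/-- The generalized BFGS update
`B - (B u uᵀ B) / ⟨u, B u⟩ + (K u uᵀ K) / ⟨u, K u⟩`; for `u = 0` it leaves `B` unchanged. -/
def bfgs {d : ℕ} (B K : Mat d) (u : Fin d → ℝ) : Mat d :=
  B - (u ⬝ᵥ (B *ᵥ u))⁻¹ • (B * Matrix.vecMulVec u u * B)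
    + (u ⬝ᵥ (K *ᵥ u))⁻¹ • (K * Matrix.vecMulVec u u * K)

/-- The `k`-th standard basis vector. -/
def stdVec {d : ℕ} (k : Fin d) : Fin d → ℝ := Pi.single k 1

/-- `u` is a greedy vector for the pair `(B, K)`: it maximizes `⟨u, B u⟩ / ⟨u, K u⟩` among the
standard basis vectors. Any choice among several maximizers is allowed. -/
def IsGreedy {d : ℕ} (B K : Mat d) (u : Fin d → ℝ) : Prop :=
  ∃ k : Fin d, u = stdVec k ∧ ∀ j : Fin d,
    (stdVec j ⬝ᵥ (B *ᵥ stdVec j)) / (stdVec j ⬝ᵥ (K *ᵥ stdVec j))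
      ≤ (u ⬝ᵥ (B *ᵥ u)) / (u ⬝ᵥ (K *ᵥ u))

/-- The approximation error `σ(B, K) = ⟨K⁻¹, B - K⟩`, where `⟨X, Y⟩ = Tr (Xᵀ Y)`. -/
def sigma {d : ℕ} (B K : Mat d) : ℝ := Matrix.trace ((K⁻¹)ᵀ * (B - K))

/-- The strong self-concordance constant `M = Lt / μ^(3/2)`. -/
def concM (μ Lt : ℝ) : ℝ := Lt / μ ^ ((3 : ℝ) / 2)

/-- The component treated at iteration `t ≥ 1`: `(t - 1) mod n`, components being numbered
`0, …, n - 1`. -/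
def idx (n : ℕ) [NeZero n] (t : ℕ) : Fin n := Fin.ofNat n (t - 1)

/-- The vector `(∑ᵢ Bᵢ)⁻¹ (∑ᵢ (Bᵢ zᵢ - ∇fᵢ(zᵢ)))`. -/
def newIterate {d n : ℕ} (f : Fin n → Vec d → ℝ) (z : Fin n → Vec d) (B : Fin n → Mat d) :
    Vec d :=
  WithLp.toLp 2 ((∑ i, B i)⁻¹ *ᵥ
    ∑ i, (B i *ᵥ (z i).ofLp - (gradient (f i) (z i)).ofLp))

/-- The scaling factor `β = (M / 2) ‖z' - z‖_z`. -/
def beta {d : ℕ} (M : ℝ) (f : Vec d → ℝ) (z z' : Vec d) : ℝ := M / 2 * localNorm f z (z' - z)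

/-- The matrix after the (scaled) classic BFGS update, when the point moves from `z` to `z'`:
`BFGS ((1 + β)² B, (1 + β) K, z' - z)`. -/
def classicUpdate {d : ℕ} (M : ℝ) (f : Vec d → ℝ) (B : Mat d) (z z' : Vec d) : Mat d :=
  bfgs ((1 + beta M f z z') ^ 2 • B) ((1 + beta M f z z') • avgHess f z z') (z' - z).ofLp

/-- `x t`, `z t i`, `B t i` are the iterates, the memorized points and the Hessian approximations
of a run of SIQN on `f 0, …, f (n - 1)`, with scaling parameter `M`, started from `x 0` and
`B 0`. -/
structure IsRun {d n : ℕ} [NeZero n] (M : ℝ) (f : Fin n → Vec d → ℝ)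
    (x : ℕ → Vec d) (z : ℕ → Fin n → Vec d) (B : ℕ → Fin n → Mat d) : Prop where
  init_z : ∀ i, z 0 i = x 0
  init_B : ∀ i, (B 0 i - hess (f i) (x 0)).PosSemidef
  step_x : ∀ t, x (t + 1) = newIterate f (z t) (B t)
  step_z : ∀ t, z (t + 1) (idx n (t + 1)) = x (t + 1)
  step_z_other : ∀ t i, i ≠ idx n (t + 1) → z (t + 1) i = z t i
  step_B : ∀ t, ∃ Q : Mat d, ∃ u : Fin d → ℝ,
    Q = classicUpdate M (f (idx n (t + 1))) (B t (idx n (t + 1)))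
      (z t (idx n (t + 1))) (z (t + 1) (idx n (t + 1))) ∧
    IsGreedy Q (hess (f (idx n (t + 1))) (z (t + 1) (idx n (t + 1)))) u ∧
    B (t + 1) (idx n (t + 1)) =
      bfgs Q (hess (f (idx n (t + 1))) (z (t + 1) (idx n (t + 1)))) u
  step_B_other : ∀ t i, i ≠ idx n (t + 1) → B (t + 1) i = B t i

/-- The constant
`δ = exp (4 M √L ε / (1 - ρ)) (σ₀ + ε · 4 M d √L / (1 - ρ / (1 - μ / (d L))))`. -/
def delta (d : ℕ) (μ L Lt ρ ε σ₀ : ℝ) : ℝ :=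
  Real.exp (4 * concM μ Lt * Real.sqrt L * ε / (1 - ρ)) *
    (σ₀ + ε * (4 * concM μ Lt * d * Real.sqrt L / (1 - ρ / (1 - μ / (d * L)))))

end SIQN

end

/-!
Every Hessian approximation overestimates the Hessian, `∇²fᵢ(zᵢ) ≤ Bᵢ`, and the scaling by `1 + β`
makes the updates preserve this order. Hence `σ(Bᵢ, ∇²fᵢ(zᵢ))` is nonnegative and `L σ` bounds
`‖Bᵢ - ∇²fᵢ(zᵢ)‖`. The new iterate satisfies
`(∑ Bᵢ) (x - x⋆) = ∑ (Bᵢ (zᵢ - x⋆) - (∇fᵢ(zᵢ) - ∇fᵢ(x⋆)))`, where each summand has norm at most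
`(L σ + Lt ‖zᵢ - x⋆‖ / 2) ‖zᵢ - x⋆‖` and `∑ Bᵢ ≥ n μ`; so as long as all `σ` and all distances are
small, the iterate is `ρ` times closer to `x⋆` than the farthest memorized point.

In an update of a component, the scaled BFGS step inflates `σ + d` by a factor of at most `(1 + β)⁴`
and the greedy step contracts `σ` by `1 - μ / (dL)`. Since `β` decays like `ρᵏ` in the number `k` of
updates of the component and `ρ < 1 - μ / (dL)`, the accumulated inflation is a convergent geometric
series, which gives `δ`. The two estimates feed each other in a single induction on the iterations.
-/

namespace SIQN

open scoped MatrixOrder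

section LoewnerOrder

variable {ι : Type*} {A B C : Matrix ι ι ℝ}

theorem posDef_of_le (hA : A.PosDef) (hAB : A ≤ B) : B.PosDef := by
  simpa using hA.add_posSemidef (Matrix.le_iff.mp hAB)

theorem posDef_of_smul_one_le [DecidableEq ι] {c : ℝ} (hc : 0 < c)
    (h : c • (1 : Matrix ι ι ℝ) ≤ A) : A.PosDef :=
  posDef_of_le (Matrix.PosDef.one.smul hc) h

theorem isHermitian_of_le (hA : A.IsHermitian) (hAB : A ≤ B) : B.IsHermitian := by
  simpa using hA.add (Matrix.le_iff.mp hAB).isHermitian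

theorem isHermitian_smul (hA : A.IsHermitian) (c : ℝ) : (c • A).IsHermitian := by
  rw [Matrix.IsHermitian, Matrix.conjTranspose_smul, hA.eq, star_trivial]

variable [Fintype ι]

theorem dotProduct_mulVec_nonneg (hA : 0 ≤ A) (v : ι → ℝ) : 0 ≤ v ⬝ᵥ (A *ᵥ v) := by
  simpa using (Matrix.nonneg_iff_posSemidef.mp hA).dotProduct_mulVec_nonneg v

theorem dotProduct_mulVec_pos (hA : A.PosDef) {v : ι → ℝ} (hv : v ≠ 0) :
    0 < v ⬝ᵥ (A *ᵥ v) := by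
  simpa using hA.dotProduct_mulVec_pos hv

theorem dotProduct_mulVec_mono (hAB : A ≤ B) (v : ι → ℝ) :
    v ⬝ᵥ (A *ᵥ v) ≤ v ⬝ᵥ (B *ᵥ v) := by
  have h := dotProduct_mulVec_nonneg (sub_nonneg.mpr hAB) v
  rwa [Matrix.sub_mulVec, dotProduct_sub, sub_nonneg] at h

theorem le_of_dotProduct_mulVec_le (hA : A.IsHermitian) (hB : B.IsHermitian)
    (h : ∀ v, v ⬝ᵥ (A *ᵥ v) ≤ v ⬝ᵥ (B *ᵥ v)) : A ≤ B := by
  refine Matrix.le_iff.mpr (Matrix.PosSemidef.of_dotProduct_mulVec_nonneg (hB.sub hA) fun v => ?_)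
  rw [star_trivial, Matrix.sub_mulVec, dotProduct_sub, sub_nonneg]
  exact h v

theorem dotProduct_mulVec_comm (hA : A.IsHermitian) (v w : ι → ℝ) :
    v ⬝ᵥ (A *ᵥ w) = w ⬝ᵥ (A *ᵥ v) := by
  rw [Matrix.dotProduct_mulVec, ← Matrix.mulVec_transpose, dotProduct_comm,
    ← Matrix.conjTranspose_eq_transpose_of_trivial, hA.eq]

theorem dotProduct_mulVec_sub_smul (hA : A.IsHermitian) (u v : ι → ℝ) (s : ℝ) :
    (v - s • u) ⬝ᵥ (A *ᵥ (v - s • u)) =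
      v ⬝ᵥ (A *ᵥ v) - 2 * s * (u ⬝ᵥ (A *ᵥ v)) + s ^ 2 * (u ⬝ᵥ (A *ᵥ u)) := by
  simp only [Matrix.mulVec_sub, Matrix.mulVec_smul, dotProduct_sub, sub_dotProduct,
    dotProduct_smul, smul_dotProduct, smul_eq_mul, dotProduct_mulVec_comm hA v u]
  ring

theorem dotProduct_mulVec_sq_le (hA : 0 ≤ A) (u v : ι → ℝ) :
    (u ⬝ᵥ (A *ᵥ v)) ^ 2 ≤ (u ⬝ᵥ (A *ᵥ u)) * (v ⬝ᵥ (A *ᵥ v)) := by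
  have hquad : ∀ s : ℝ, 0 ≤ (u ⬝ᵥ (A *ᵥ u)) * (s * s) + (-2 * (u ⬝ᵥ (A *ᵥ v))) * s
      + v ⬝ᵥ (A *ᵥ v) := fun s => by
    have h := dotProduct_mulVec_nonneg hA (v - s • u)
    rw [dotProduct_mulVec_sub_smul (Matrix.nonneg_iff_posSemidef.mp hA).isHermitian] at h
    linarith
  have hdiscrim := discrim_le_zero hquad
  rw [discrim] at hdiscrim
  linarith

theorem trace_mul_nonneg (hA : 0 ≤ A) (hB : 0 ≤ B) : 0 ≤ (A * B).trace := by
  classical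
  obtain ⟨R, rfl⟩ := CStarAlgebra.nonneg_iff_eq_star_mul_self.mp hA
  rw [mul_assoc, Matrix.trace_mul_comm]
  exact ((Matrix.nonneg_iff_posSemidef.mp hB).mul_mul_conjTranspose_same R).trace_nonneg

theorem trace_mul_le_trace_mul_right (hAB : A ≤ B) (hC : 0 ≤ C) :
    (A * C).trace ≤ (B * C).trace := by
  have h := trace_mul_nonneg (sub_nonneg.mpr hAB) hC
  rwa [Matrix.sub_mul, Matrix.trace_sub, sub_nonneg] at h

theorem dotProduct_mulVec_self_le_trace_sq (hA : 0 ≤ A) (v : ι → ℝ) :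
    (A *ᵥ v) ⬝ᵥ (A *ᵥ v) ≤ A.trace ^ 2 * (v ⬝ᵥ v) := by
  classical
  have hentry (i j : ι) : A i j ^ 2 ≤ A i i * A j j := by
    simpa using dotProduct_mulVec_sq_le hA (Pi.single i 1) (Pi.single j 1)
  have hcoord (i : ι) : (A *ᵥ v) i ^ 2 ≤ A i i * A.trace * (v ⬝ᵥ v) :=
    calc (A *ᵥ v) i ^ 2 ≤ (∑ j, A i j ^ 2) * ∑ j, v j ^ 2 :=
          Finset.sum_mul_sq_le_sq_mul_sq Finset.univ (A i) v
      _ ≤ (∑ j, A i i * A j j) * ∑ j, v j ^ 2 := by gcongr; exact hentry i _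
      _ = A i i * A.trace * (v ⬝ᵥ v) := by
          simp only [← Finset.mul_sum, Matrix.trace, Matrix.diag_apply, dotProduct, sq]
  calc (A *ᵥ v) ⬝ᵥ (A *ᵥ v) = ∑ i, (A *ᵥ v) i ^ 2 := by simp only [dotProduct, sq]
    _ ≤ ∑ i, A i i * A.trace * (v ⬝ᵥ v) := Finset.sum_le_sum fun i _ => hcoord i
    _ = A.trace ^ 2 * (v ⬝ᵥ v) := by rw [← Finset.sum_mul, ← Finset.sum_mul, sq]; rfl

variable [DecidableEq ι]

theorem dotProduct_smul_one_mulVec (c : ℝ) (v : ι → ℝ) :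
    v ⬝ᵥ ((c • (1 : Matrix ι ι ℝ)) *ᵥ v) = c * (v ⬝ᵥ v) := by
  rw [Matrix.smul_mulVec, Matrix.one_mulVec, dotProduct_smul, smul_eq_mul]

theorem inv_le_inv_of_le (hA : A.PosDef) (hAB : A ≤ B) : B⁻¹ ≤ A⁻¹ := by
  have hB := posDef_of_le hA hAB
  have := hA.inv.isUnit.invertible
  have := hB.isUnit.invertible
  have hblock : (Matrix.fromBlocks B 1 (1 : Matrix ι ι ℝ)ᴴ A⁻¹).PosSemidef := by
    rw [Matrix.PosDef.fromBlocks₂₂ B 1 hA.inv]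
    simpa [Matrix.nonsing_inv_nonsing_inv A (A.isUnit_iff_isUnit_det.mp hA.isUnit)] using
      Matrix.le_iff.mp hAB
  rw [Matrix.PosDef.fromBlocks₁₁ 1 A⁻¹ hB] at hblock
  simpa [Matrix.le_iff] using hblock

theorem inv_le_smul_inv {c : ℝ} (hc : 0 < c) (hA : A.PosDef) (h : A ≤ c • B) :
    B⁻¹ ≤ c • A⁻¹ := by
  have hB : B = c⁻¹ • (c • B) := (inv_smul_smul₀ hc.ne' B).symm
  have hdet := (c • B).isUnit_iff_isUnit_det.mp (posDef_of_le hA h).isUnit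
  have hinv : B⁻¹ = c • (c • B)⁻¹ := by
    have := Matrix.inv_smul' (c • B) (Units.mk0 c⁻¹ (inv_ne_zero hc.ne')) hdet
    rw [hB]
    simpa [Units.smul_def, hc.ne'] using this
  rw [hinv]
  exact smul_le_smul_of_nonneg_left (inv_le_inv_of_le hA h) hc.le

theorem mulVec_inv_mulVec (hA : A.PosDef) (v : ι → ℝ) : A *ᵥ (A⁻¹ *ᵥ v) = v := by
  rw [Matrix.mulVec_mulVec, Matrix.mul_nonsing_inv A (A.isUnit_iff_isUnit_det.mp hA.isUnit),
    Matrix.one_mulVec]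

theorem inv_mulVec_mulVec (hA : A.PosDef) (v : ι → ℝ) : A⁻¹ *ᵥ (A *ᵥ v) = v := by
  rw [Matrix.mulVec_mulVec, Matrix.nonsing_inv_mul A (A.isUnit_iff_isUnit_det.mp hA.isUnit),
    Matrix.one_mulVec]

theorem dotProduct_sq_le_mul_inv (hA : A.PosDef) (v w : ι → ℝ) :
    (v ⬝ᵥ w) ^ 2 ≤ (v ⬝ᵥ (A *ᵥ v)) * (w ⬝ᵥ (A⁻¹ *ᵥ w)) := by
  simpa only [mulVec_inv_mulVec hA, dotProduct_comm (A⁻¹ *ᵥ w)] using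
    dotProduct_mulVec_sq_le hA.posSemidef.nonneg v (A⁻¹ *ᵥ w)

end LoewnerOrder

section Deflation

variable {ι : Type*} [Fintype ι] {A B : Matrix ι ι ℝ}

/-- The rank one correction `A - (A u uᵀ A) / ⟨u, A u⟩`. For positive semidefinite `A` its
quadratic form is `v ↦ min_s ⟨v - s u, A (v - s u)⟩`, so it is monotone in `A`; a BFGS update
replaces the correction of `B` by that of `K`. -/
noncomputable def deflate (A : Matrix ι ι ℝ) (u : ι → ℝ) : Matrix ι ι ℝ :=
  A - (u ⬝ᵥ (A *ᵥ u))⁻¹ • (A * Matrix.vecMulVec u u * A)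

theorem isHermitian_deflate (hA : A.IsHermitian) (u : ι → ℝ) : (deflate A u).IsHermitian := by
  have huu : (Matrix.vecMulVec u u).IsHermitian := by
    simp [Matrix.IsHermitian, Matrix.transpose_vecMulVec]
  have h := Matrix.isHermitian_mul_mul_conjTranspose A huu
  rw [hA.eq] at h
  exact hA.sub (isHermitian_smul h _)

theorem dotProduct_deflate_mulVec (hA : A.IsHermitian) (u v : ι → ℝ) :
    v ⬝ᵥ (deflate A u *ᵥ v) =
      v ⬝ᵥ (A *ᵥ v) - (u ⬝ᵥ (A *ᵥ u))⁻¹ * (u ⬝ᵥ (A *ᵥ v)) ^ 2 := by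
  simp only [deflate, Matrix.sub_mulVec, Matrix.smul_mulVec, ← Matrix.mulVec_mulVec,
    Matrix.vecMulVec_mulVec, Matrix.mulVec_smul, dotProduct_sub, dotProduct_smul,
    op_smul_eq_smul, smul_eq_mul, dotProduct_mulVec_comm hA v u]
  ring

theorem dotProduct_deflate_mulVec_le (hA : 0 ≤ A) (u v : ι → ℝ) (s : ℝ) :
    v ⬝ᵥ (deflate A u *ᵥ v) ≤ (v - s • u) ⬝ᵥ (A *ᵥ (v - s • u)) := by
  have hherm := (Matrix.nonneg_iff_posSemidef.mp hA).isHermitian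
  rw [dotProduct_deflate_mulVec hherm, dotProduct_mulVec_sub_smul hherm]
  have hcs := dotProduct_mulVec_sq_le hA u v
  rcases (dotProduct_mulVec_nonneg hA u).eq_or_lt with ha | ha
  · rw [← ha, zero_mul] at hcs
    have hc : u ⬝ᵥ (A *ᵥ v) = 0 := by nlinarith
    simp [hc, ← ha]
  · have hsquare : 0 ≤ (u ⬝ᵥ (A *ᵥ u))⁻¹ * (s * (u ⬝ᵥ (A *ᵥ u)) - u ⬝ᵥ (A *ᵥ v)) ^ 2 := by
      positivity
    have hexpand : (u ⬝ᵥ (A *ᵥ u))⁻¹ * (s * (u ⬝ᵥ (A *ᵥ u)) - u ⬝ᵥ (A *ᵥ v)) ^ 2 =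
        s ^ 2 * (u ⬝ᵥ (A *ᵥ u)) - 2 * s * (u ⬝ᵥ (A *ᵥ v))
          + (u ⬝ᵥ (A *ᵥ u))⁻¹ * (u ⬝ᵥ (A *ᵥ v)) ^ 2 := by
      field_simp
      ring
    linarith

theorem exists_dotProduct_deflate_mulVec_eq (hA : A.IsHermitian) (u v : ι → ℝ) :
    ∃ s : ℝ, v ⬝ᵥ (deflate A u *ᵥ v) = (v - s • u) ⬝ᵥ (A *ᵥ (v - s • u)) := by
  refine ⟨(u ⬝ᵥ (A *ᵥ u))⁻¹ * (u ⬝ᵥ (A *ᵥ v)), ?_⟩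
  rw [dotProduct_deflate_mulVec hA, dotProduct_mulVec_sub_smul hA]
  have hinv := mul_self_mul_inv (u ⬝ᵥ (A *ᵥ u))⁻¹
  rw [inv_inv] at hinv
  linear_combination -(u ⬝ᵥ (A *ᵥ v)) ^ 2 * hinv

theorem trace_mul_deflate (P : Matrix ι ι ℝ) (hA : A.IsHermitian) (u : ι → ℝ) :
    (P * deflate A u).trace =
      (P * A).trace - (u ⬝ᵥ (A *ᵥ u))⁻¹ * ((A *ᵥ u) ⬝ᵥ (P *ᵥ (A *ᵥ u))) := by
  have hrow : u ᵥ* A = A *ᵥ u := by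
    rw [← Matrix.mulVec_transpose, ← Matrix.conjTranspose_eq_transpose_of_trivial, hA.eq]
  rw [deflate, Matrix.mul_sub, Matrix.trace_sub, Matrix.mul_smul, Matrix.trace_smul, smul_eq_mul,
    Matrix.mul_vecMulVec, Matrix.vecMulVec_mul, hrow, Matrix.mul_vecMulVec, Matrix.trace_vecMulVec,
    dotProduct_comm (P *ᵥ (A *ᵥ u))]

theorem deflate_mono (hA : 0 ≤ A) (hAB : A ≤ B) (u : ι → ℝ) : deflate A u ≤ deflate B u := by
  have hAh := (Matrix.nonneg_iff_posSemidef.mp hA).isHermitian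
  have hBh := isHermitian_of_le hAh hAB
  refine le_of_dotProduct_mulVec_le (isHermitian_deflate hAh u) (isHermitian_deflate hBh u)
    fun v => ?_
  obtain ⟨s, hs⟩ := exists_dotProduct_deflate_mulVec_eq hBh u v
  calc v ⬝ᵥ (deflate A u *ᵥ v) ≤ (v - s • u) ⬝ᵥ (A *ᵥ (v - s • u)) :=
        dotProduct_deflate_mulVec_le hA u v s
    _ ≤ (v - s • u) ⬝ᵥ (B *ᵥ (v - s • u)) := dotProduct_mulVec_mono hAB _
    _ = v ⬝ᵥ (deflate B u *ᵥ v) := hs.symm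

end Deflation

section Bfgs

variable {d : ℕ} {B K : Mat d}

theorem bfgs_eq (B K : Mat d) (u : Fin d → ℝ) :
    bfgs B K u = deflate B u - deflate K u + K := by
  simp only [bfgs, deflate]
  abel

theorem bfgs_zero (B K : Mat d) : bfgs B K 0 = B := by
  simp [bfgs]

theorem le_bfgs (hK : 0 ≤ K) (hKB : K ≤ B) (u : Fin d → ℝ) : K ≤ bfgs B K u := by
  rw [bfgs_eq]
  exact le_add_of_nonneg_left (sub_nonneg.mpr (deflate_mono hK hKB u))

theorem one_le_dotProduct_div (hK : K.PosDef) (hKB : K ≤ B) {u : Fin d → ℝ} (hu : u ≠ 0) :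
    1 ≤ (u ⬝ᵥ (B *ᵥ u)) / (u ⬝ᵥ (K *ᵥ u)) :=
  (one_le_div (dotProduct_mulVec_pos hK hu)).mpr (dotProduct_mulVec_mono hKB u)

theorem transpose_inv_eq (hK : K.PosDef) : (K⁻¹)ᵀ = K⁻¹ := by
  rw [← Matrix.conjTranspose_eq_transpose_of_trivial, hK.inv.isHermitian.eq]

theorem sigma_nonneg (hK : K.PosDef) (hKB : K ≤ B) : 0 ≤ sigma B K := by
  rw [sigma, transpose_inv_eq hK]
  exact trace_mul_nonneg hK.inv.posSemidef.nonneg (sub_nonneg.mpr hKB)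

theorem sigma_add_eq_trace (hK : K.PosDef) (B : Mat d) : sigma B K + d = (K⁻¹ * B).trace := by
  rw [sigma, transpose_inv_eq hK, Matrix.mul_sub, Matrix.trace_sub,
    Matrix.nonsing_inv_mul K (K.isUnit_iff_isUnit_det.mp hK.isUnit), Matrix.trace_one,
    Fintype.card_fin, sub_add_cancel]

theorem sigma_smul_add (hK : K.PosDef) (B : Mat d) (c : ℝ) :
    sigma (c • B) K + d = c * (sigma B K + d) := by
  rw [sigma_add_eq_trace hK, sigma_add_eq_trace hK, Matrix.mul_smul, Matrix.trace_smul,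
    smul_eq_mul]

theorem sigma_add_le_of_le_smul {H : Mat d} {c : ℝ} (hc : 0 < c) (hK : K.PosDef) (hH : H.PosDef)
    (h : K ≤ c • H) (hB : 0 ≤ B) : sigma B H + d ≤ c * (sigma B K + d) := by
  have htrace := trace_mul_le_trace_mul_right (inv_le_smul_inv hc hK h) hB
  rwa [Matrix.smul_mul, Matrix.trace_smul, smul_eq_mul, ← sigma_add_eq_trace hH,
    ← sigma_add_eq_trace hK] at htrace

theorem trace_sub_le_sigma {L : ℝ} (hL : 0 < L) (hK : K.PosDef) (hKL : K ≤ L • 1)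
    (hKB : K ≤ B) : (B - K).trace ≤ L * sigma B K := by
  have h := trace_mul_le_trace_mul_right (inv_le_smul_inv hL hK hKL) (sub_nonneg.mpr hKB)
  rwa [inv_one, one_mul, Matrix.smul_mul, Matrix.trace_smul, ← transpose_inv_eq hK] at h

theorem sigma_le_trace_sub {μ : ℝ} (hμ : 0 < μ) (hK : μ • 1 ≤ K) (hKB : K ≤ B) :
    sigma B K ≤ μ⁻¹ * (B - K).trace := by
  have hone : 1 ≤ μ⁻¹ • K := by
    simpa [hμ.ne'] using smul_le_smul_of_nonneg_left hK (inv_nonneg.mpr hμ.le)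
  have h := trace_mul_le_trace_mul_right
    (inv_le_smul_inv (inv_pos.mpr hμ) Matrix.PosDef.one hone) (sub_nonneg.mpr hKB)
  rwa [inv_one, Matrix.smul_mul, one_mul, Matrix.trace_smul,
    ← transpose_inv_eq (posDef_of_smul_one_le hμ hK)] at h

theorem sigma_bfgs_add_le (hK : K.PosDef) (hKB : K ≤ B) {u : Fin d → ℝ} (hu : u ≠ 0) :
    sigma (bfgs B K u) K + ((u ⬝ᵥ (B *ᵥ u)) / (u ⬝ᵥ (K *ᵥ u)) - 1) ≤ sigma B K := by
  have hB := posDef_of_le hK hKB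
  have hKu := dotProduct_mulVec_pos hK hu
  have hBu := dotProduct_mulVec_pos hB hu
  have hratio : (u ⬝ᵥ (B *ᵥ u)) / (u ⬝ᵥ (K *ᵥ u)) ≤
      (u ⬝ᵥ (B *ᵥ u))⁻¹ * ((B *ᵥ u) ⬝ᵥ (K⁻¹ *ᵥ (B *ᵥ u))) := by
    rw [inv_mul_eq_div, div_le_div_iff₀ hKu hBu, ← sq, mul_comm _ (u ⬝ᵥ (K *ᵥ u))]
    exact dotProduct_sq_le_mul_inv hK u (B *ᵥ u)
  have htrace : (K⁻¹ * bfgs B K u).trace = (K⁻¹ * B).trace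
      - (u ⬝ᵥ (B *ᵥ u))⁻¹ * ((B *ᵥ u) ⬝ᵥ (K⁻¹ *ᵥ (B *ᵥ u))) + 1 := by
    rw [bfgs_eq, Matrix.mul_add, Matrix.mul_sub, Matrix.trace_add, Matrix.trace_sub,
      trace_mul_deflate _ hB.isHermitian, trace_mul_deflate _ hK.isHermitian,
      inv_mulVec_mulVec hK, dotProduct_comm (K *ᵥ u), inv_mul_cancel₀ hKu.ne']
    ring
  rw [← sigma_add_eq_trace hK, ← sigma_add_eq_trace hK] at htrace
  linarith

theorem sigma_bfgs_le (hK : K.PosDef) (hKB : K ≤ B) (u : Fin d → ℝ) :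
    sigma (bfgs B K u) K ≤ sigma B K := by
  rcases eq_or_ne u 0 with rfl | hu
  · rw [bfgs_zero]
  · linarith [sigma_bfgs_add_le hK hKB hu, one_le_dotProduct_div hK hKB hu]

theorem trace_sub_le_of_isGreedy {L : ℝ} (hK : K.PosDef) (hKL : K ≤ L • 1) (hKB : K ≤ B)
    {u : Fin d → ℝ} (hu : IsGreedy B K u) :
    (B - K).trace ≤ d * (L * ((u ⬝ᵥ (B *ᵥ u)) / (u ⬝ᵥ (K *ᵥ u)) - 1)) := by
  obtain ⟨k, rfl, hmax⟩ := hu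
  have hne (j : Fin d) : stdVec j ≠ 0 := by simp [stdVec]
  have hone := one_le_dotProduct_div hK hKB (hne k)
  set r := (stdVec k ⬝ᵥ (B *ᵥ stdVec k)) / (stdVec k ⬝ᵥ (K *ᵥ stdVec k))
  have hdiag (A : Mat d) (j : Fin d) : stdVec j ⬝ᵥ (A *ᵥ stdVec j) = A j j := by
    simp [stdVec]
  have hentry (j : Fin d) : (B - K) j j ≤ L * (r - 1) := by
    have hB := hmax j
    have hL := dotProduct_mulVec_mono hKL (stdVec j)
    rw [div_le_iff₀ (dotProduct_mulVec_pos hK (hne j))] at hB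
    simp only [hdiag, Matrix.smul_apply, Matrix.one_apply_eq, smul_eq_mul, mul_one] at hB hL
    rw [Matrix.sub_apply]
    nlinarith
  calc (B - K).trace ≤ ∑ _j : Fin d, L * (r - 1) := Finset.sum_le_sum fun j _ => hentry j
    _ = d * (L * (r - 1)) := by simp

theorem sigma_bfgs_greedy_le {H Q : Mat d} {μ L : ℝ} (hμ : 0 < μ) (hL : 0 < L) (hμH : μ • 1 ≤ H)
    (hHL : H ≤ L • 1) (hHQ : H ≤ Q) {u : Fin d → ℝ} (hu : IsGreedy Q H u) :
    sigma (bfgs Q H u) H ≤ (1 - μ / (d * L)) * sigma Q H := by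
  have hH := posDef_of_smul_one_le hμ hμH
  obtain ⟨hd, hu0⟩ : 0 < d ∧ u ≠ 0 := by
    obtain ⟨k, rfl, -⟩ := hu
    exact ⟨k.pos, by simp [stdVec]⟩
  have hgain : μ / (d * L) * sigma Q H ≤ (u ⬝ᵥ (Q *ᵥ u)) / (u ⬝ᵥ (H *ᵥ u)) - 1 :=
    calc μ / (d * L) * sigma Q H
        ≤ μ / (d * L) * (μ⁻¹ * (d * (L * ((u ⬝ᵥ (Q *ᵥ u)) / (u ⬝ᵥ (H *ᵥ u)) - 1)))) := by
          gcongr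
          exact (sigma_le_trace_sub hμ hμH hHQ).trans
            (by gcongr; exact trace_sub_le_of_isGreedy hH hHL hHQ hu)
      _ = (u ⬝ᵥ (Q *ᵥ u)) / (u ⬝ᵥ (H *ᵥ u)) - 1 := by field_simp
  linarith [sigma_bfgs_add_le hH hHQ hu0]

section ScaledUpdate

variable {H H' : Mat d} {c : ℝ}

theorem smul_le_sq_smul (hc : 0 < c) (hKH : K ≤ c • H) (hHB : H ≤ B) : c • K ≤ c ^ 2 • B := by
  rw [sq, mul_smul]
  exact smul_le_smul_of_nonneg_left
    (hKH.trans (smul_le_smul_of_nonneg_left hHB hc.le)) hc.le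

theorem le_bfgs_smul (hc : 0 < c) (hK : 0 ≤ K) (hKH : K ≤ c • H) (hHB : H ≤ B)
    (hH'K : H' ≤ c • K) (u : Fin d → ℝ) : H' ≤ bfgs (c ^ 2 • B) (c • K) u :=
  hH'K.trans (le_bfgs (smul_nonneg hc.le hK) (smul_le_sq_smul hc hKH hHB) u)

/-- All traces are compared through the intermediate metric `c • K`, which dominates `H`. -/
theorem sigma_bfgs_smul_add_le (hc : 0 < c) (hK : K.PosDef) (hH : H.PosDef) (hH' : H'.PosDef)
    (hKH : K ≤ c • H) (hHK : H ≤ c • K) (hKH' : K ≤ c • H') (hHB : H ≤ B) (u : Fin d → ℝ) :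
    sigma (bfgs (c ^ 2 • B) (c • K) u) H' + d ≤ c ^ 4 * (sigma B H + d) := by
  have hcK : (c • K).PosDef := hK.smul hc
  have hKB := smul_le_sq_smul hc hKH hHB
  have hQ : 0 ≤ bfgs (c ^ 2 • B) (c • K) u :=
    hcK.posSemidef.nonneg.trans (le_bfgs hcK.posSemidef.nonneg hKB u)
  have hB : 0 ≤ c ^ 2 • B := hcK.posSemidef.nonneg.trans hKB
  have hcKH' : c • K ≤ c ^ 2 • H' := by
    rw [sq, mul_smul]
    exact smul_le_smul_of_nonneg_left hKH' hc.le
  calc sigma (bfgs (c ^ 2 • B) (c • K) u) H' + d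
      ≤ c ^ 2 * (sigma (bfgs (c ^ 2 • B) (c • K) u) (c • K) + d) :=
        sigma_add_le_of_le_smul (by positivity) hcK hH' hcKH' hQ
    _ ≤ c ^ 2 * (sigma (c ^ 2 • B) (c • K) + d) := by gcongr; exact sigma_bfgs_le hcK hKB u
    _ ≤ c ^ 2 * (1 * (sigma (c ^ 2 • B) H + d)) := by
        gcongr
        exact sigma_add_le_of_le_smul one_pos hH hcK (by rwa [one_smul]) hB
    _ = c ^ 4 * (sigma B H + d) := by rw [sigma_smul_add hH]; ring

end ScaledUpdate

end Bfgs

section SpectralNorm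

variable {d : ℕ} {A B : Mat d}

theorem norm_sq_eq_dotProduct (v : Vec d) : ‖v‖ ^ 2 = v.ofLp ⬝ᵥ v.ofLp := by
  rw [EuclideanSpace.norm_sq_eq]
  simp only [Real.norm_eq_abs, sq_abs, dotProduct, ← sq]

theorem specNorm_sub_rev (A B : Mat d) : specNorm (A - B) = specNorm (B - A) := by
  rw [specNorm, specNorm, map_sub, map_sub, norm_sub_rev]

theorem specNorm_sub_le_specNorm_sub_add_specNorm_sub (A B C : Mat d) :
    specNorm (A - C) ≤ specNorm (A - B) + specNorm (B - C) := by
  simp only [specNorm, map_sub]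
  exact norm_sub_le_norm_sub_add_norm_sub _ _ _

theorem norm_mulVec_le_specNorm (A : Mat d) (v : Vec d) :
    ‖WithLp.toLp 2 (A *ᵥ v.ofLp)‖ ≤ specNorm A * ‖v‖ :=
  (Matrix.toEuclideanCLM (𝕜 := ℝ) A).le_opNorm v

theorem dotProduct_mulVec_le_specNorm (A : Mat d) (v : Vec d) :
    v.ofLp ⬝ᵥ (A *ᵥ v.ofLp) ≤ specNorm A * ‖v‖ ^ 2 := by
  rw [← Matrix.inner_toEuclideanCLM]
  calc inner ℝ v (Matrix.toEuclideanCLM (𝕜 := ℝ) A v)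
      ≤ ‖v‖ * ‖Matrix.toEuclideanCLM (𝕜 := ℝ) A v‖ := real_inner_le_norm _ _
    _ ≤ ‖v‖ * (specNorm A * ‖v‖) := by gcongr; exact norm_mulVec_le_specNorm A v
    _ = specNorm A * ‖v‖ ^ 2 := by ring

theorem specNorm_le_trace (hA : 0 ≤ A) : specNorm A ≤ A.trace := by
  have htrace := (Matrix.nonneg_iff_posSemidef.mp hA).trace_nonneg
  refine ContinuousLinearMap.opNorm_le_bound _ htrace fun v => ?_
  refine abs_le_of_sq_le_sq' ?_ (by positivity) |>.2
  rw [mul_pow, norm_sq_eq_dotProduct, norm_sq_eq_dotProduct, Matrix.ofLp_toEuclideanCLM]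
  exact dotProduct_mulVec_self_le_trace_sq hA v.ofLp

theorem le_norm_mulVec {c : ℝ} (h : c • 1 ≤ A) (v : Vec d) :
    c * ‖v‖ ≤ ‖WithLp.toLp 2 (A *ᵥ v.ofLp)‖ := by
  rcases eq_or_ne v 0 with rfl | hv
  · simp
  refine le_of_mul_le_mul_right ?_ (norm_pos_iff.mpr hv)
  calc c * ‖v‖ * ‖v‖ = c * (v.ofLp ⬝ᵥ v.ofLp) := by rw [← norm_sq_eq_dotProduct]; ring
    _ ≤ v.ofLp ⬝ᵥ (A *ᵥ v.ofLp) := by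
        rw [← dotProduct_smul_one_mulVec]
        exact dotProduct_mulVec_mono h v.ofLp
    _ ≤ ‖WithLp.toLp 2 (A *ᵥ v.ofLp)‖ * ‖v‖ := by
        rw [← Matrix.inner_toEuclideanCLM, mul_comm]
        exact real_inner_le_norm _ _

theorem le_smul_of_specNorm_sub_le {μ β : ℝ} (hA : A.IsHermitian) (hβ : 0 ≤ β)
    (hB : B.IsHermitian) (hμB : μ • 1 ≤ B) (h : specNorm (A - B) ≤ β * μ) :
    A ≤ (1 + β) • B := by
  refine le_of_dotProduct_mulVec_le hA (isHermitian_smul hB _) fun v => ?_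
  have hdiff := dotProduct_mulVec_le_specNorm (A - B) (WithLp.toLp 2 v)
  have hμ := dotProduct_mulVec_mono hμB v
  rw [dotProduct_smul_one_mulVec] at hμ
  rw [norm_sq_eq_dotProduct, Matrix.sub_mulVec, dotProduct_sub] at hdiff
  have hv : 0 ≤ v ⬝ᵥ v := by simpa using dotProduct_star_self_nonneg v
  calc v ⬝ᵥ (A *ᵥ v) ≤ v ⬝ᵥ (B *ᵥ v) + β * μ * (v ⬝ᵥ v) := by nlinarith
    _ ≤ v ⬝ᵥ (B *ᵥ v) + β * (v ⬝ᵥ (B *ᵥ v)) := by rw [mul_assoc]; gcongr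
    _ = v ⬝ᵥ (((1 + β) • B) *ᵥ v) := by
        rw [Matrix.smul_mulVec, dotProduct_smul, smul_eq_mul]; ring

end SpectralNorm

section Calculus

open Filter Topology

section Segment

variable {E F : Type*} [NormedAddCommGroup E] [NormedSpace ℝ E] [NormedAddCommGroup F]
  [NormedSpace ℝ F] [CompleteSpace F]

theorem norm_integral_segment_sub_le {φ : E → F} (hφ : Continuous φ) {C : ℝ} {x : E}
    (hC : ∀ z, ‖φ z - φ x‖ ≤ C * ‖z - x‖) (y : E) :
    ‖(∫ τ in (0 : ℝ)..1, φ (x + τ • (y - x))) - φ x‖ ≤ C / 2 * ‖y - x‖ := by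
  have hcont : Continuous fun τ : ℝ => φ (x + τ • (y - x)) := hφ.comp (by fun_prop)
  have hsub : (∫ τ in (0 : ℝ)..1, φ (x + τ • (y - x))) - φ x =
      ∫ τ in (0 : ℝ)..1, (φ (x + τ • (y - x)) - φ x) := by
    rw [intervalIntegral.integral_sub (hcont.intervalIntegrable 0 1) (by simp)]
    simp
  have hbound (τ : ℝ) (hτ : τ ∈ Set.Ioc (0 : ℝ) 1) :
      ‖φ (x + τ • (y - x)) - φ x‖ ≤ C * ‖y - x‖ * τ := by
    have h := hC (x + τ • (y - x))
    rw [add_sub_cancel_left, norm_smul, Real.norm_of_nonneg hτ.1.le] at h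
    linarith
  calc ‖(∫ τ in (0 : ℝ)..1, φ (x + τ • (y - x))) - φ x‖
      ≤ ∫ τ in (0 : ℝ)..1, C * ‖y - x‖ * τ := by
        rw [hsub]
        exact intervalIntegral.norm_integral_le_of_norm_le zero_le_one
          (Filter.Eventually.of_forall hbound) ((by fun_prop : Continuous _).intervalIntegrable 0 1)
    _ = C / 2 * ‖y - x‖ := by
        rw [intervalIntegral.integral_const_mul, integral_id]
        ring

theorem integral_segment_fderiv {g : E → F} (hg : ContDiff ℝ 1 g) (x y : E) :
    (∫ τ in (0 : ℝ)..1, fderiv ℝ g (x + τ • (y - x))) (y - x) = g y - g x := by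
  have hcont : Continuous fun τ : ℝ => fderiv ℝ g (x + τ • (y - x)) :=
    (hg.continuous_fderiv one_ne_zero).comp (by fun_prop)
  have htaylor := map_add_eq_sum_add_integral_iteratedFDeriv (n := 0) (f := g) (x := x)
    (y := y - x) fun _ _ => by simpa using hg.contDiffAt
  rw [ContinuousLinearMap.intervalIntegral_apply (hcont.intervalIntegrable 0 1)]
  rw [add_sub_cancel] at htaylor
  simp [htaylor]

end Segment

theorem le_inner_of_hasFDerivAt {E : Type*} [NormedAddCommGroup E] [InnerProductSpace ℝ E]
    {g : E → E} {g' : E →L[ℝ] E} {x : E} {c : ℝ} (hg : HasFDerivAt g g' x)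
    (h : ∀ y, c * ‖y - x‖ ^ 2 ≤ inner ℝ (y - x) (g y - g x)) (v : E) :
    c * ‖v‖ ^ 2 ≤ inner ℝ v (g' v) := by
  have hslope := (tendsto_const_nhds (x := v)).inner (𝕜 := ℝ)
    (hg.hasLineDerivAt v).tendsto_slope_zero_right
  refine ge_of_tendsto hslope ?_
  filter_upwards [self_mem_nhdsWithin] with t (ht : 0 < t)
  have ht' := h (x + t • v)
  rw [add_sub_cancel_left, norm_smul, mul_pow, inner_smul_left, Real.norm_eq_abs, sq_abs] at ht'
  rw [inner_smul_right, inv_mul_eq_div, le_div_iff₀ ht]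
  refine le_of_mul_le_mul_left ?_ ht
  calc t * (c * ‖v‖ ^ 2 * t) = c * (t ^ 2 * ‖v‖ ^ 2) := by ring
    _ ≤ t * inner ℝ v (g (x + t • v) - g x) := ht'

section Hessian

variable {d : ℕ} {f : Vec d → ℝ}

theorem gradient_apply (f : Vec d → ℝ) (x : Vec d) (i : Fin d) :
    gradient f x i = fderiv ℝ f x (EuclideanSpace.single i 1) := by
  rw [← toDual_gradient, InnerProductSpace.toDual_apply_apply, EuclideanSpace.inner_single_right]
  simp

theorem contDiff_gradient (hf : ContDiff ℝ 2 f) : ContDiff ℝ 1 (gradient f) := by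
  refine contDiff_euclidean.mpr fun i => ?_
  simp only [gradient_apply]
  exact (hf.fderiv_right (by norm_num)).clm_apply contDiff_const

theorem fderiv_gradient_apply (hf : ContDiff ℝ 2 f) (x v : Vec d) (i : Fin d) :
    fderiv ℝ (gradient f) x v i =
      fderiv ℝ (fun y => fderiv ℝ f y) x v (EuclideanSpace.single i 1) := by
  have hgrad := ((contDiff_gradient hf).differentiable one_ne_zero x).hasFDerivAt
  have hfderiv := (((hf.fderiv_right (m := 1) (by norm_num)).differentiable one_ne_zero
    x).hasFDerivAt).clm_apply (hasFDerivAt_const (EuclideanSpace.single i (1 : ℝ)) x)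
  simp only [← gradient_apply] at hfderiv
  have hcoord : HasFDerivAt (fun y => gradient f y i) _ x :=
    (EuclideanSpace.proj i : Vec d →L[ℝ] ℝ).hasFDerivAt.comp x hgrad
  simpa using congrArg (· v) (hcoord.unique hfderiv)

theorem toEuclideanCLM_hess (hf : ContDiff ℝ 2 f) (x : Vec d) :
    Matrix.toEuclideanCLM (𝕜 := ℝ) (hess f x) = fderiv ℝ (gradient f) x := by
  have hsymm := (hf.contDiffAt (x := x)).isSymmSndFDerivAt (by simp)
  refine ContinuousLinearMap.coe_injective
    ((EuclideanSpace.basisFun (Fin d) ℝ).toBasis.ext fun j => ?_)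
  ext i
  simpa [fderiv_gradient_apply hf, hess] using hsymm _ _

theorem isHermitian_hess (hf : ContDiff ℝ 2 f) (x : Vec d) : (hess f x).IsHermitian := by
  ext i j
  exact (hf.contDiffAt (x := x)).isSymmSndFDerivAt (by simp) _ _

theorem dotProduct_hess_mulVec (hf : ContDiff ℝ 2 f) (x : Vec d) (v : Fin d → ℝ) :
    v ⬝ᵥ (hess f x *ᵥ v) =
      inner ℝ (WithLp.toLp 2 v) (fderiv ℝ (gradient f) x (WithLp.toLp 2 v)) := by
  rw [← toEuclideanCLM_hess hf, Matrix.inner_toEuclideanCLM]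

theorem StronglyConvex.le_inner_gradient_sub {μ : ℝ} (h : StronglyConvex μ f) (x y : Vec d) :
    μ * ‖y - x‖ ^ 2 ≤ inner ℝ (y - x) (gradient f y - gradient f x) := by
  have hxy := h x y
  have hyx := h y x
  rw [norm_sub_rev, ← neg_sub y x, inner_neg_right] at hyx
  rw [real_inner_comm, inner_sub_left]
  linarith

theorem Smooth.inner_gradient_sub_le {L : ℝ} (h : Smooth L f) (x y : Vec d) :
    inner ℝ (y - x) (gradient f y - gradient f x) ≤ L * ‖y - x‖ ^ 2 := by
  have hxy := h x y
  have hyx := h y x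
  rw [norm_sub_rev, ← neg_sub y x, inner_neg_right] at hyx
  rw [real_inner_comm, inner_sub_left]
  linarith

theorem StronglyConvex.smul_one_le_hess {μ : ℝ} (h : StronglyConvex μ f) (hf : ContDiff ℝ 2 f)
    (x : Vec d) : μ • 1 ≤ hess f x := by
  refine le_of_dotProduct_mulVec_le (isHermitian_smul Matrix.isHermitian_one μ)
    (isHermitian_hess hf x) fun v => ?_
  have hgrad := ((contDiff_gradient hf).differentiable one_ne_zero x).hasFDerivAt
  have hv := le_inner_of_hasFDerivAt hgrad (h.le_inner_gradient_sub x) (WithLp.toLp 2 v)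
  rwa [← dotProduct_hess_mulVec hf, norm_sq_eq_dotProduct, ← dotProduct_smul_one_mulVec] at hv

theorem Smooth.hess_le_smul_one {L : ℝ} (h : Smooth L f) (hf : ContDiff ℝ 2 f) (x : Vec d) :
    hess f x ≤ L • 1 := by
  refine le_of_dotProduct_mulVec_le (isHermitian_hess hf x)
    (isHermitian_smul Matrix.isHermitian_one L) fun v => ?_
  have hgrad := ((contDiff_gradient hf).differentiable one_ne_zero x).hasFDerivAt
  have hneg (y : Vec d) :
      -L * ‖y - x‖ ^ 2 ≤ inner ℝ (y - x) ((-gradient f) y - (-gradient f) x) := by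
    have hy := h.inner_gradient_sub_le x y
    rw [Pi.neg_apply, Pi.neg_apply, neg_sub_neg, ← neg_sub (gradient f y), inner_neg_right]
    linarith
  have hv := le_inner_of_hasFDerivAt hgrad.neg hneg (WithLp.toLp 2 v)
  rw [neg_apply, inner_neg_right, ← dotProduct_hess_mulVec hf,
    norm_sq_eq_dotProduct, neg_mul, neg_le_neg_iff] at hv
  rwa [dotProduct_smul_one_mulVec]

theorem continuous_hess (hf : ContDiff ℝ 2 f) :
    Continuous fun x => Matrix.toEuclideanCLM (𝕜 := ℝ) (hess f x) := by
  simp only [toEuclideanCLM_hess hf]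
  exact (contDiff_gradient hf).continuous_fderiv one_ne_zero

theorem toEuclideanCLM_avgHess (hf : ContDiff ℝ 2 f) (x y : Vec d) :
    Matrix.toEuclideanCLM (𝕜 := ℝ) (avgHess f x y) =
      ∫ τ in (0 : ℝ)..1, Matrix.toEuclideanCLM (𝕜 := ℝ) (hess f (x + τ • (y - x))) := by
  have hint : IntervalIntegrable
      (fun τ : ℝ => Matrix.toEuclideanCLM (𝕜 := ℝ) (hess f (x + τ • (y - x))))
      MeasureTheory.volume 0 1 :=
    ((continuous_hess hf).comp (by fun_prop)).intervalIntegrable 0 1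
  refine ContinuousLinearMap.coe_injective
    ((EuclideanSpace.basisFun (Fin d) ℝ).toBasis.ext fun j => ?_)
  ext i
  have hentry := ((EuclideanSpace.proj i : Vec d →L[ℝ] ℝ).comp (ContinuousLinearMap.apply ℝ (Vec d)
    (EuclideanSpace.single j (1 : ℝ)))).intervalIntegral_comp_comm hint
  simpa [avgHess] using hentry

theorem avgHess_comm (f : Vec d → ℝ) (x y : Vec d) : avgHess f x y = avgHess f y x := by
  ext i j
  have hreverse := intervalIntegral.integral_comp_sub_left (a := 0) (b := 1)
    (fun τ : ℝ => hess f (x + τ • (y - x)) i j) 1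
  rw [sub_zero, sub_self] at hreverse
  have hpoint (τ : ℝ) : y + τ • (x - y) = x + (1 - τ) • (y - x) := by module
  simp only [avgHess, Matrix.of_apply, hpoint, hreverse]

theorem isHermitian_avgHess (hf : ContDiff ℝ 2 f) (x y : Vec d) :
    (avgHess f x y).IsHermitian := by
  ext i j
  simp only [Matrix.conjTranspose_apply, avgHess, Matrix.of_apply, star_trivial]
  congr with τ
  simpa using (isHermitian_hess hf (x + τ • (y - x))).apply i j

theorem avgHess_mulVec_sub (hf : ContDiff ℝ 2 f) (x y : Vec d) :
    WithLp.toLp 2 (avgHess f x y *ᵥ (y - x).ofLp) = gradient f y - gradient f x := by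
  have h := integral_segment_fderiv (contDiff_gradient hf) x y
  simp only [← toEuclideanCLM_hess hf, ← toEuclideanCLM_avgHess hf] at h
  exact h

theorem StronglyConvex.smul_one_le_avgHess {μ : ℝ} (h : StronglyConvex μ f)
    (hf : ContDiff ℝ 2 f) (x y : Vec d) : μ • 1 ≤ avgHess f x y := by
  refine le_of_dotProduct_mulVec_le (isHermitian_smul Matrix.isHermitian_one μ)
    (isHermitian_avgHess hf x y) fun v => ?_
  have hcont : Continuous fun τ : ℝ =>
      Matrix.toEuclideanCLM (𝕜 := ℝ) (hess f (x + τ • (y - x))) :=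
    (continuous_hess hf).comp (by fun_prop)
  have hquad := ((innerSL ℝ (WithLp.toLp 2 v)).comp
    (ContinuousLinearMap.apply ℝ (Vec d) (WithLp.toLp 2 v))).intervalIntegral_comp_comm
      (hcont.intervalIntegrable (μ := MeasureTheory.volume) 0 1)
  simp only [← toEuclideanCLM_avgHess hf, ContinuousLinearMap.comp_apply, innerSL_apply_apply,
    ContinuousLinearMap.apply_apply, Matrix.inner_toEuclideanCLM] at hquad
  have hint : IntervalIntegrable (fun τ : ℝ => v ⬝ᵥ (hess f (x + τ • (y - x)) *ᵥ v))
      MeasureTheory.volume 0 1 := by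
    simp only [← Matrix.inner_toEuclideanCLM (x := WithLp.toLp 2 v)]
    exact (Continuous.inner continuous_const
      (hcont.clm_apply continuous_const)).intervalIntegrable 0 1
  calc v ⬝ᵥ ((μ • 1 : Mat d) *ᵥ v)
      = ∫ _ in (0 : ℝ)..1, v ⬝ᵥ ((μ • 1 : Mat d) *ᵥ v) := by simp
    _ ≤ ∫ τ in (0 : ℝ)..1, v ⬝ᵥ (hess f (x + τ • (y - x)) *ᵥ v) :=
        intervalIntegral.integral_mono zero_le_one (by simp) hint fun τ =>
          dotProduct_mulVec_mono (h.smul_one_le_hess hf _) v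
    _ = v ⬝ᵥ (avgHess f x y *ᵥ v) := hquad

theorem HessLipschitz.specNorm_avgHess_sub_hess_le {Lt : ℝ} (h : HessLipschitz Lt f)
    (hf : ContDiff ℝ 2 f) (x y : Vec d) :
    specNorm (avgHess f x y - hess f x) ≤ Lt / 2 * ‖y - x‖ := by
  rw [specNorm, map_sub, toEuclideanCLM_avgHess hf]
  refine norm_integral_segment_sub_le (continuous_hess hf) (fun z => ?_) y
  rw [← map_sub]
  exact h x z

theorem sqrt_mul_norm_le_localNorm {μ : ℝ} (hμ : 0 ≤ μ) {x : Vec d} (h : μ • 1 ≤ hess f x)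
    (v : Vec d) : √μ * ‖v‖ ≤ localNorm f x v := by
  refine Real.le_sqrt_of_sq_le ?_
  rw [mul_pow, Real.sq_sqrt hμ, norm_sq_eq_dotProduct, ← dotProduct_smul_one_mulVec]
  exact dotProduct_mulVec_mono h v.ofLp

theorem localNorm_le_sqrt_mul_norm {L : ℝ} (hL : 0 ≤ L) {x : Vec d} (h : hess f x ≤ L • 1)
    (v : Vec d) : localNorm f x v ≤ √L * ‖v‖ := by
  refine Real.sqrt_le_iff.mpr ⟨by positivity, ?_⟩
  rw [mul_pow, Real.sq_sqrt hL, norm_sq_eq_dotProduct, ← dotProduct_smul_one_mulVec]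
  exact dotProduct_mulVec_mono h v.ofLp

end Hessian

section SelfConcordance

variable {d : ℕ} {f : Vec d → ℝ} {μ Lt : ℝ}

theorem concM_nonneg (hμ : 0 ≤ μ) (hLt : 0 ≤ Lt) : 0 ≤ concM μ Lt :=
  div_nonneg hLt (Real.rpow_nonneg hμ _)

theorem avgHess_le_smul_hess {β : ℝ} {x y : Vec d} (hβ : 0 ≤ β) (hf : ContDiff ℝ 2 f)
    (hsc : StronglyConvex μ f) (hLip : HessLipschitz Lt f) (h : Lt / 2 * ‖y - x‖ ≤ β * μ) :
    avgHess f x y ≤ (1 + β) • hess f x :=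
  le_smul_of_specNorm_sub_le (isHermitian_avgHess hf x y) hβ (isHermitian_hess hf x)
    (hsc.smul_one_le_hess hf x) ((hLip.specNorm_avgHess_sub_hess_le hf x y).trans h)

theorem hess_le_smul_avgHess {β : ℝ} {x y : Vec d} (hβ : 0 ≤ β) (hf : ContDiff ℝ 2 f)
    (hsc : StronglyConvex μ f) (hLip : HessLipschitz Lt f) (h : Lt / 2 * ‖y - x‖ ≤ β * μ) :
    hess f x ≤ (1 + β) • avgHess f x y := by
  refine le_smul_of_specNorm_sub_le (isHermitian_hess hf x) hβ (isHermitian_avgHess hf x y)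
    (hsc.smul_one_le_avgHess hf x y) ?_
  rw [specNorm_sub_rev]
  exact (hLip.specNorm_avgHess_sub_hess_le hf x y).trans h

end SelfConcordance

end Calculus

/-- The standing assumptions on a component function: it is `C²`, `μ`-strongly convex and
`L`-smooth, and its Hessian is `Lt`-Lipschitz. -/
structure IsAdmissible {d : ℕ} (μ L Lt : ℝ) (f : Vec d → ℝ) : Prop where
  contDiff : ContDiff ℝ 2 f
  stronglyConvex : StronglyConvex μ f
  smooth : Smooth L f
  hessLipschitz : HessLipschitz Lt f

namespace IsAdmissible

variable {d : ℕ} {μ L Lt : ℝ} {f : Vec d → ℝ} {B : Mat d} {z : Vec d}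

theorem smul_one_le_hess (h : IsAdmissible μ L Lt f) (x : Vec d) : μ • 1 ≤ hess f x :=
  h.stronglyConvex.smul_one_le_hess h.contDiff x

theorem hess_le_smul_one (h : IsAdmissible μ L Lt f) (x : Vec d) : hess f x ≤ L • 1 :=
  h.smooth.hess_le_smul_one h.contDiff x

theorem posDef_hess (h : IsAdmissible μ L Lt f) (hμ : 0 < μ) (x : Vec d) :
    (hess f x).PosDef :=
  posDef_of_smul_one_le hμ (h.smul_one_le_hess x)

theorem posDef_avgHess (h : IsAdmissible μ L Lt f) (hμ : 0 < μ) (x y : Vec d) :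
    (avgHess f x y).PosDef :=
  posDef_of_smul_one_le hμ (h.stronglyConvex.smul_one_le_avgHess h.contDiff x y)

variable [NeZero d]

theorem le_smoothness (h : IsAdmissible μ L Lt f) : μ ≤ L := by
  obtain ⟨v, hv⟩ := exists_ne (0 : Vec d)
  have hnorm : 0 < ‖v - 0‖ ^ 2 := by rw [sub_zero]; exact pow_pos (norm_pos_iff.mpr hv) 2
  have hμL := (h.stronglyConvex 0 v).trans (h.smooth 0 v)
  linarith [le_of_mul_le_mul_right hμL hnorm]

theorem lipschitz_nonneg (h : IsAdmissible μ L Lt f) : 0 ≤ Lt := by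
  obtain ⟨v, hv⟩ := exists_ne (0 : Vec d)
  have hnorm : 0 < ‖v - 0‖ := by simpa using hv
  exact nonneg_of_mul_nonneg_left ((norm_nonneg _).trans (h.hessLipschitz 0 v)) hnorm

theorem beta_nonneg (h : IsAdmissible μ L Lt f) (hμ : 0 ≤ μ) (x y : Vec d) :
    0 ≤ beta (concM μ Lt) f x y :=
  mul_nonneg (div_nonneg (concM_nonneg hμ h.lipschitz_nonneg) zero_le_two) (Real.sqrt_nonneg _)

theorem half_mul_norm_le_beta_mul (h : IsAdmissible μ L Lt f) (hμ : 0 < μ) (x y : Vec d) :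
    Lt / 2 * ‖y - x‖ ≤ beta (concM μ Lt) f x y * μ := by
  have hpow : μ ^ ((3 : ℝ) / 2) = μ * √μ := by
    rw [show (3 : ℝ) / 2 = 1 + 1 / 2 by norm_num, Real.rpow_add hμ, Real.rpow_one,
      Real.sqrt_eq_rpow]
  have : 0 < √μ := Real.sqrt_pos.mpr hμ
  have hLt := h.lipschitz_nonneg
  calc Lt / 2 * ‖y - x‖ = Lt / (μ * √μ) / 2 * (√μ * ‖y - x‖) * μ := by field_simp
    _ ≤ Lt / (μ * √μ) / 2 * localNorm f x (y - x) * μ := by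
        gcongr
        exact sqrt_mul_norm_le_localNorm hμ.le (h.smul_one_le_hess x) (y - x)
    _ = beta (concM μ Lt) f x y * μ := by rw [beta, concM, hpow]

theorem avgHess_le_smul_hess_left (h : IsAdmissible μ L Lt f) (hμ : 0 < μ) (x y : Vec d) :
    avgHess f x y ≤ (1 + beta (concM μ Lt) f x y) • hess f x :=
  avgHess_le_smul_hess (h.beta_nonneg hμ.le x y) h.contDiff h.stronglyConvex h.hessLipschitz
    (h.half_mul_norm_le_beta_mul hμ x y)

theorem hess_left_le_smul_avgHess (h : IsAdmissible μ L Lt f) (hμ : 0 < μ) (x y : Vec d) :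
    hess f x ≤ (1 + beta (concM μ Lt) f x y) • avgHess f x y :=
  hess_le_smul_avgHess (h.beta_nonneg hμ.le x y) h.contDiff h.stronglyConvex h.hessLipschitz
    (h.half_mul_norm_le_beta_mul hμ x y)

theorem avgHess_le_smul_hess_right (h : IsAdmissible μ L Lt f) (hμ : 0 < μ) (x y : Vec d) :
    avgHess f x y ≤ (1 + beta (concM μ Lt) f x y) • hess f y := by
  rw [avgHess_comm]
  refine avgHess_le_smul_hess (h.beta_nonneg hμ.le x y) h.contDiff h.stronglyConvex
    h.hessLipschitz ?_
  rw [norm_sub_rev]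
  exact h.half_mul_norm_le_beta_mul hμ x y

theorem hess_right_le_smul_avgHess (h : IsAdmissible μ L Lt f) (hμ : 0 < μ) (x y : Vec d) :
    hess f y ≤ (1 + beta (concM μ Lt) f x y) • avgHess f x y := by
  rw [avgHess_comm]
  refine hess_le_smul_avgHess (h.beta_nonneg hμ.le x y) h.contDiff h.stronglyConvex
    h.hessLipschitz ?_
  rw [norm_sub_rev]
  exact h.half_mul_norm_le_beta_mul hμ x y

theorem le_classicUpdate (h : IsAdmissible μ L Lt f) (hμ : 0 < μ) (hB : hess f z ≤ B)
    (z' : Vec d) : hess f z' ≤ classicUpdate (concM μ Lt) f B z z' :=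
  le_bfgs_smul (by linarith [h.beta_nonneg hμ.le z z'])
    (h.posDef_avgHess hμ z z').posSemidef.nonneg (h.avgHess_le_smul_hess_left hμ z z') hB
    (h.hess_right_le_smul_avgHess hμ z z') _

theorem sigma_classicUpdate_add_le (h : IsAdmissible μ L Lt f) (hμ : 0 < μ)
    (hB : hess f z ≤ B) (z' : Vec d) :
    sigma (classicUpdate (concM μ Lt) f B z z') (hess f z') + d ≤
      (1 + beta (concM μ Lt) f z z') ^ 4 * (sigma B (hess f z) + d) :=
  sigma_bfgs_smul_add_le (by linarith [h.beta_nonneg hμ.le z z']) (h.posDef_avgHess hμ z z')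
    (h.posDef_hess hμ z) (h.posDef_hess hμ z') (h.avgHess_le_smul_hess_left hμ z z')
    (h.hess_left_le_smul_avgHess hμ z z') (h.avgHess_le_smul_hess_right hμ z z') hB _

theorem norm_residual_le (h : IsAdmissible μ L Lt f) (hμ : 0 < μ) (hB : hess f z ≤ B)
    (y : Vec d) :
    ‖WithLp.toLp 2 (B *ᵥ (z - y).ofLp) - (gradient f z - gradient f y)‖ ≤
      (L * sigma B (hess f z) + Lt / 2 * ‖z - y‖) * ‖z - y‖ := by
  have hresidual : WithLp.toLp 2 (B *ᵥ (z - y).ofLp) - (gradient f z - gradient f y) =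
      WithLp.toLp 2 ((B - avgHess f y z) *ᵥ (z - y).ofLp) := by
    rw [← avgHess_mulVec_sub h.contDiff y z, Matrix.sub_mulVec, WithLp.toLp_sub]
  have htrace : specNorm (B - hess f z) ≤ L * sigma B (hess f z) :=
    (specNorm_le_trace (sub_nonneg.mpr hB)).trans <|
      trace_sub_le_sigma (hμ.trans_le h.le_smoothness) (h.posDef_hess hμ z)
        (h.hess_le_smul_one z) hB
  have hlip : specNorm (hess f z - avgHess f y z) ≤ Lt / 2 * ‖z - y‖ := by
    rw [specNorm_sub_rev, avgHess_comm, norm_sub_rev]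
    exact h.hessLipschitz.specNorm_avgHess_sub_hess_le h.contDiff z y
  calc ‖WithLp.toLp 2 (B *ᵥ (z - y).ofLp) - (gradient f z - gradient f y)‖
      ≤ specNorm (B - avgHess f y z) * ‖z - y‖ := by
        rw [hresidual]
        exact norm_mulVec_le_specNorm _ _
    _ ≤ (L * sigma B (hess f z) + Lt / 2 * ‖z - y‖) * ‖z - y‖ := by
        gcongr
        exact (specNorm_sub_le_specNorm_sub_add_specNorm_sub _ _ _).trans (add_le_add htrace hlip)

end IsAdmissible

section Iterate

variable {d n : ℕ} {f : Fin n → Vec d → ℝ}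

theorem sum_gradient_eq_zero [NeZero n] {xs : Vec d}
    (hf : ∀ i, DifferentiableAt ℝ (f i) xs)
    (hmin : IsMinOn (fun y => (1 / (n : ℝ)) * ∑ i, f i y) Set.univ xs) :
    ∑ i, gradient (f i) xs = 0 := by
  have hcrit := (hmin.isLocalMin Filter.univ_mem).fderiv_eq_zero
  have hmean : HasFDerivAt (fun y => (1 / (n : ℝ)) * ∑ i, f i y)
      ((1 / (n : ℝ)) • ∑ i, fderiv ℝ (f i) xs) xs :=
    (HasFDerivAt.fun_sum fun i _ => (hf i).hasFDerivAt).const_mul _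
  rw [hmean.fderiv, smul_eq_zero_iff_right (by simp [NeZero.ne n])] at hcrit
  simp only [gradient, ← map_sum, hcrit, map_zero]

theorem natCast_mul_smul_one_le_sum {B : Fin n → Mat d} {c : ℝ} (hB : ∀ i, c • 1 ≤ B i) :
    (n * c) • 1 ≤ ∑ i, B i := by
  calc ((n * c) • 1 : Mat d) = ∑ _i : Fin n, c • 1 := by
        simp [mul_smul, Nat.cast_smul_eq_nsmul]
    _ ≤ ∑ i, B i := Finset.sum_le_sum fun i _ => hB i

theorem sum_mulVec_newIterate_sub {z : Fin n → Vec d} {B : Fin n → Mat d} {xs : Vec d}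
    (hB : (∑ i, B i).PosDef) (hxs : ∑ i, gradient (f i) xs = 0) :
    WithLp.toLp 2 ((∑ i, B i) *ᵥ (newIterate f z B - xs).ofLp) =
      ∑ i, (WithLp.toLp 2 (B i *ᵥ (z i - xs).ofLp) -
        (gradient (f i) (z i) - gradient (f i) xs)) := by
  simp only [newIterate, WithLp.ofLp_sub, Matrix.mulVec_sub, mulVec_inv_mulVec hB,
    Matrix.sum_mulVec, WithLp.toLp_sub, WithLp.toLp_sum, Finset.sum_sub_distrib, hxs,
    WithLp.toLp_ofLp]
  abel

theorem norm_newIterate_sub_le [NeZero n] {z : Fin n → Vec d} {B : Fin n → Mat d} {xs : Vec d}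
    {μ c : ℝ} (hμ : 0 < μ) (hB : ∀ i, μ • 1 ≤ B i) (hxs : ∑ i, gradient (f i) xs = 0)
    (hc : ∀ i, ‖WithLp.toLp 2 (B i *ᵥ (z i - xs).ofLp) -
      (gradient (f i) (z i) - gradient (f i) xs)‖ ≤ c) :
    ‖newIterate f z B - xs‖ ≤ c / μ := by
  have hn : (0 : ℝ) < n := Nat.cast_pos'.mpr (Nat.pos_of_neZero n)
  have hsum := natCast_mul_smul_one_le_sum hB
  have hlower := le_norm_mulVec hsum (newIterate f z B - xs)
  rw [sum_mulVec_newIterate_sub (posDef_of_smul_one_le (by positivity) hsum) hxs] at hlower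
  have hupper := norm_sum_le_of_le Finset.univ fun i _ => hc i
  rw [Finset.sum_const, Finset.card_univ, Fintype.card_fin, nsmul_eq_mul] at hupper
  rw [le_div_iff₀ hμ, mul_comm]
  exact le_of_mul_le_mul_left (by linarith) hn

end Iterate

section Schedule

variable (n : ℕ) [NeZero n]

/-- The number of updates of component `i` during the first `t` iterations. -/
def updateCount (i : Fin n) (t : ℕ) : ℕ := Nat.count (fun s => idx n (s + 1) = i) t

variable {n}

theorem idx_succ_eq_iff (s : ℕ) (i : Fin n) : idx n (s + 1) = i ↔ s ≡ i [MOD n] := by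
  rw [Fin.ext_iff, Nat.ModEq, Nat.mod_eq_of_lt i.isLt]
  simp [idx, Fin.ofNat]

theorem updateCount_succ_self (t : ℕ) :
    updateCount n (idx n (t + 1)) (t + 1) = updateCount n (idx n (t + 1)) t + 1 := by
  simp [updateCount, Nat.count_succ]

theorem updateCount_succ_of_ne {i : Fin n} {t : ℕ} (h : i ≠ idx n (t + 1)) :
    updateCount n i (t + 1) = updateCount n i t := by
  simp [updateCount, Nat.count_succ, h.symm]

theorem updateCount_eq (i : Fin n) (t : ℕ) :
    updateCount n i t = t / n + if i < t % n then 1 else 0 := by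
  simp only [updateCount, idx_succ_eq_iff]
  rw [Nat.count_modEq_card _ (Nat.pos_of_neZero n), Nat.mod_eq_of_lt i.isLt]

theorem div_le_updateCount (i : Fin n) (t : ℕ) : t / n ≤ updateCount n i t := by
  rw [updateCount_eq]
  exact Nat.le_add_right _ _

theorem updateCount_idx_succ (t : ℕ) : updateCount n (idx n (t + 1)) t = t / n := by
  have hidx : (idx n (t + 1) : ℕ) = t % n := by simp [idx, Fin.ofNat]
  simp [updateCount_eq, hidx]

theorem ceil_succ_div (n t : ℕ) [NeZero n] : ⌈((t + 1 : ℕ) : ℝ) / n⌉₊ = t / n + 1 := by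
  have hn : (0 : ℝ) < n := Nat.cast_pos'.mpr (Nat.pos_of_neZero n)
  have hmod := Nat.mod_lt t (Nat.pos_of_neZero n)
  have hdiv := Nat.div_add_mod t n
  rw [Nat.ceil_eq_iff (Nat.succ_ne_zero _), lt_div_iff₀ hn, div_le_iff₀ hn]
  norm_cast
  rw [Nat.succ_sub_one, Nat.succ_mul, mul_comm (t / n)]
  omega

end Schedule

section Rates

theorem one_add_pow_four_mul_add_sub_le {b s D x : ℝ} (hb : 0 ≤ b) (hs : 0 ≤ s) (hD : 0 ≤ D)
    (hx : 4 * b ≤ x) : (1 + b) ^ 4 * (s + D) - D ≤ Real.exp x * (s + D * x) := by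
  have hpow : (1 + b) ^ 4 ≤ Real.exp x := by
    calc (1 + b) ^ 4 ≤ Real.exp b ^ 4 := by gcongr; linarith [Real.add_one_le_exp b]
      _ = Real.exp (4 * b) := by rw [← Real.exp_nat_mul]; norm_num
      _ ≤ Real.exp x := Real.exp_le_exp.mpr hx
  have hexp : Real.exp x - 1 ≤ Real.exp x * x := by
    have h := mul_le_mul_of_nonneg_left (Real.add_one_le_exp (-x)) (Real.exp_nonneg x)
    rw [← Real.exp_add, add_neg_cancel, Real.exp_zero] at h
    linarith
  calc (1 + b) ^ 4 * (s + D) - D ≤ Real.exp x * (s + D) - D := by gcongr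
    _ = Real.exp x * s + D * (Real.exp x - 1) := by ring
    _ ≤ Real.exp x * s + D * (Real.exp x * x) := by gcongr
    _ = Real.exp x * (s + D * x) := by ring

/-- An upper bound for the solution of `E (k + 1) = a * exp (x k) * (E k + D * x k)`, `E 0 = σ₀`,
obtained by moving every exponential factor out of the sum. It bounds the approximation error of a
component after `k` updates when `x k` bounds four times the `k`-th scaling factor. -/
noncomputable def errBound (a D σ₀ : ℝ) (x : ℕ → ℝ) (k : ℕ) : ℝ :=
  a ^ k * (Real.exp (∑ j ∈ Finset.range k, x j) *
    (σ₀ + D * ∑ j ∈ Finset.range k, x j / a ^ j))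

theorem mul_exp_mul_errBound_add_le {a D σ₀ : ℝ} {x : ℕ → ℝ} (ha : 0 < a) (hD : 0 ≤ D)
    (hx : ∀ j, 0 ≤ x j) (k : ℕ) :
    a * (Real.exp (x k) * (errBound a D σ₀ x k + D * x k)) ≤ errBound a D σ₀ x (k + 1) := by
  have hxk := hx k
  have hexp : 1 ≤ Real.exp (∑ j ∈ Finset.range k, x j) :=
    Real.one_le_exp (Finset.sum_nonneg fun j _ => hx j)
  have hterm : D * x k ≤
      a ^ k * (Real.exp (∑ j ∈ Finset.range k, x j) * (D * (x k / a ^ k))) := by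
    calc D * x k = a ^ k * (1 * (D * (x k / a ^ k))) := by field_simp
      _ ≤ a ^ k * (Real.exp (∑ j ∈ Finset.range k, x j) * (D * (x k / a ^ k))) := by gcongr
  calc a * (Real.exp (x k) * (errBound a D σ₀ x k + D * x k))
      ≤ a * (Real.exp (x k) * (errBound a D σ₀ x k +
          a ^ k * (Real.exp (∑ j ∈ Finset.range k, x j) * (D * (x k / a ^ k))))) := by gcongr
    _ = errBound a D σ₀ x (k + 1) := by
        rw [errBound, errBound, Finset.sum_range_succ, Finset.sum_range_succ, Real.exp_add]
        ring

theorem errBound_geometric_le {a ρ γ D σ₀ : ℝ} (hρ : 0 ≤ ρ) (hρ1 : ρ < 1) (hρa : ρ < a)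
    (hγ : 0 ≤ γ) (hD : 0 ≤ D) (hσ₀ : 0 ≤ σ₀) (k : ℕ) :
    errBound a D σ₀ (fun j => γ * ρ ^ j) k ≤
      a ^ k * (Real.exp (γ / (1 - ρ)) * (σ₀ + D * (γ / (1 - ρ / a)))) := by
  have ha : 0 < a := hρ.trans_lt hρa
  have hgeom {r : ℝ} (hr : 0 ≤ r) (hr1 : r < 1) :
      ∑ j ∈ Finset.range k, γ * r ^ j ≤ γ / (1 - r) := by
    rw [← Finset.mul_sum, div_eq_mul_inv, ← tsum_geometric_of_lt_one hr hr1]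
    gcongr
    exact (summable_geometric_of_lt_one hr hr1).sum_le_tsum _ fun j _ => by positivity
  have hratio := hgeom (div_nonneg hρ ha.le) ((div_lt_one ha).mpr hρa)
  simp only [div_pow, ← mul_div_assoc] at hratio
  have : 0 ≤ ∑ j ∈ Finset.range k, γ * ρ ^ j / a ^ j :=
    Finset.sum_nonneg fun j _ => by positivity
  unfold errBound
  gcongr
  exact hgeom hρ hρ1

theorem exists_mul_delta_add_le (d : ℕ) {μ L Lt ρ : ℝ} (hμ : 0 < μ) (hρ : 0 < ρ) :
    ∃ ε : ℝ, 0 < ε ∧ L * delta d μ L Lt ρ ε ε + Lt / 2 * ε ≤ ρ * μ := by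
  have hcont : Continuous fun ε : ℝ => L * delta d μ L Lt ρ ε ε + Lt / 2 * ε := by
    unfold delta
    fun_prop
  have hzero : L * delta d μ L Lt ρ 0 0 + Lt / 2 * 0 < ρ * μ := by
    simpa [delta] using mul_pos hρ hμ
  have hnear : ∀ᶠ ε in nhdsWithin (0 : ℝ) (Set.Ioi 0),
      L * delta d μ L Lt ρ ε ε + Lt / 2 * ε < ρ * μ :=
    nhdsWithin_le_nhds ((hcont.tendsto 0).eventually_lt_const hzero)
  obtain ⟨ε, hle, hpos⟩ := (hnear.and self_mem_nhdsWithin).exists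
  exact ⟨ε, hpos, hle.le⟩

end Rates

section Convergence

variable {d : ℕ} {μ L Lt ρ r σ₀ : ℝ} {xs : Vec d}

/-- The state of a component after `k` updates in a run started at distance `r` from the minimizer
`xs` with approximation errors at most `σ₀`: its memorized point is `ρ ^ k * r`-close to `xs`, and
its Hessian approximation overestimates the Hessian with an error controlled by `errBound`. -/
structure MemoryBound (μ L Lt ρ r σ₀ : ℝ) (xs : Vec d) (f : Vec d → ℝ) (k : ℕ) (z : Vec d)
    (B : Mat d) : Prop where
  norm_le : ‖z - xs‖ ≤ ρ ^ k * r
  hess_le : hess f z ≤ B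
  sigma_le : sigma B (hess f z) ≤
    errBound (1 - μ / (d * L)) d σ₀ (fun j => 4 * concM μ Lt * √L * r * ρ ^ j) k

theorem errBound_le_pow_mul_delta (hM : 0 ≤ concM μ Lt) (hρ : 0 ≤ ρ) (hρ1 : ρ < 1)
    (hρa : ρ < 1 - μ / (d * L)) (hr : 0 ≤ r) (hσ₀ : 0 ≤ σ₀) (k : ℕ) :
    errBound (1 - μ / (d * L)) d σ₀ (fun j => 4 * concM μ Lt * √L * r * ρ ^ j) k ≤
      (1 - μ / (d * L)) ^ k * delta d μ L Lt ρ r σ₀ := by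
  refine (errBound_geometric_le hρ hρ1 hρa (by positivity) d.cast_nonneg hσ₀ k).trans_eq ?_
  rw [delta]
  ring_nf

theorem delta_mono {ε : ℝ} (hM : 0 ≤ concM μ Lt) (hρ : 0 ≤ ρ) (hρ1 : ρ < 1)
    (hρa : ρ < 1 - μ / (d * L)) (hr : 0 ≤ r) (hrε : r ≤ ε) (hσ₀ : 0 ≤ σ₀) :
    delta d μ L Lt ρ r σ₀ ≤ delta d μ L Lt ρ ε σ₀ := by
  have : 0 < 1 - ρ := sub_pos.mpr hρ1
  have hratio : 0 < 1 - ρ / (1 - μ / (d * L)) :=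
    sub_pos.mpr ((div_lt_one (hρ.trans_lt hρa)).mpr hρa)
  unfold delta
  gcongr

theorem IsRun.memoryBound_zero {n : ℕ} [NeZero n] {f : Fin n → Vec d → ℝ} {x : ℕ → Vec d}
    {z : ℕ → Fin n → Vec d} {B : ℕ → Fin n → Mat d} (hrun : IsRun (concM μ Lt) f x z B)
    (hσ : ∀ i, sigma (B 0 i) (hess (f i) (x 0)) ≤ σ₀) (i : Fin n) :
    MemoryBound μ L Lt ρ ‖x 0 - xs‖ σ₀ xs (f i) 0 (z 0 i) (B 0 i) where
  norm_le := by simp [hrun.init_z]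
  hess_le := by
    rw [hrun.init_z]
    exact Matrix.le_iff.mpr (hrun.init_B i)
  sigma_le := by simpa [errBound, hrun.init_z] using hσ i

variable [NeZero d]

theorem IsAdmissible.lt_one_of_lt_rate {f : Vec d → ℝ} (h : IsAdmissible μ L Lt f) (hμ : 0 < μ)
    (hρa : ρ < 1 - μ / (d * L)) : ρ < 1 := by
  have hL : 0 < L := hμ.trans_le h.le_smoothness
  linarith [show 0 ≤ μ / (d * L) by positivity]

namespace MemoryBound

variable {f : Vec d → ℝ} {k : ℕ} {z z' : Vec d} {B : Mat d}

theorem sigma_le_delta (hb : MemoryBound μ L Lt ρ r σ₀ xs f k z B)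
    (h : IsAdmissible μ L Lt f) (hμ : 0 < μ) (hρ : 0 ≤ ρ) (hρa : ρ < 1 - μ / (d * L))
    (hr : 0 ≤ r) (hσ₀ : 0 ≤ σ₀) : sigma B (hess f z) ≤ delta d μ L Lt ρ r σ₀ := by
  have hL : 0 < L := hμ.trans_le h.le_smoothness
  have ha : 0 < 1 - μ / (d * L) := hρ.trans_lt hρa
  have ha1 : 1 - μ / (d * L) ≤ 1 := sub_le_self _ (by positivity)
  have hσ := hb.sigma_le.trans <| errBound_le_pow_mul_delta (concM_nonneg hμ.le h.lipschitz_nonneg)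
    hρ (h.lt_one_of_lt_rate hμ hρa) hρa hr hσ₀ k
  have hδ : 0 ≤ delta d μ L Lt ρ r σ₀ := nonneg_of_mul_nonneg_right
    ((sigma_nonneg (h.posDef_hess hμ z) hb.hess_le).trans hσ) (pow_pos ha k)
  exact hσ.trans (mul_le_of_le_one_left hδ (pow_le_one₀ ha.le ha1))

theorem norm_residual_le (hb : MemoryBound μ L Lt ρ r σ₀ xs f k z B)
    (h : IsAdmissible μ L Lt f) (hμ : 0 < μ) (hρ : 0 ≤ ρ) (hρa : ρ < 1 - μ / (d * L))
    (hr : 0 ≤ r) (hσ₀ : 0 ≤ σ₀) (hδ : L * delta d μ L Lt ρ r σ₀ + Lt / 2 * r ≤ ρ * μ)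
    {m : ℕ} (hm : m ≤ k) :
    ‖WithLp.toLp 2 (B *ᵥ (z - xs).ofLp) - (gradient f z - gradient f xs)‖ ≤
      ρ * μ * (ρ ^ m * r) := by
  have hL : 0 < L := hμ.trans_le h.le_smoothness
  have hLt := h.lipschitz_nonneg
  have hρ1 := (h.lt_one_of_lt_rate hμ hρa).le
  have hzm : ‖z - xs‖ ≤ ρ ^ m * r :=
    hb.norm_le.trans (mul_le_mul_of_nonneg_right (pow_le_pow_of_le_one hρ hρ1 hm) hr)
  have hzr : ‖z - xs‖ ≤ r :=
    hb.norm_le.trans (mul_le_of_le_one_left hr (pow_le_one₀ hρ hρ1))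
  have hcoeff : L * sigma B (hess f z) + Lt / 2 * ‖z - xs‖ ≤ ρ * μ := by
    refine le_trans ?_ hδ
    gcongr
    exact hb.sigma_le_delta h hμ hρ hρa hr hσ₀
  exact (h.norm_residual_le hμ hb.hess_le xs).trans
    (mul_le_mul hcoeff hzm (norm_nonneg _) (by positivity))

theorem four_mul_beta_le (hb : MemoryBound μ L Lt ρ r σ₀ xs f k z B)
    (h : IsAdmissible μ L Lt f) (hμ : 0 < μ) (hz' : ‖z' - xs‖ ≤ ρ ^ k * r) :
    4 * beta (concM μ Lt) f z z' ≤ 4 * concM μ Lt * √L * r * ρ ^ k := by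
  have hL : 0 ≤ L := hμ.le.trans h.le_smoothness
  have hM := concM_nonneg hμ.le h.lipschitz_nonneg
  have hstep : ‖z' - z‖ ≤ ρ ^ k * r + ρ ^ k * r := by
    refine (norm_sub_le_norm_sub_add_norm_sub z' xs z).trans (add_le_add hz' ?_)
    rw [norm_sub_rev]
    exact hb.norm_le
  calc 4 * beta (concM μ Lt) f z z'
      ≤ 4 * (concM μ Lt / 2 * (√L * (ρ ^ k * r + ρ ^ k * r))) := by
        unfold beta
        gcongr
        exact (localNorm_le_sqrt_mul_norm hL (h.hess_le_smul_one z) _).trans (by gcongr)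
    _ = 4 * concM μ Lt * √L * r * ρ ^ k := by ring

theorem update (hb : MemoryBound μ L Lt ρ r σ₀ xs f k z B)
    (h : IsAdmissible μ L Lt f) (hμ : 0 < μ) (hρ : 0 ≤ ρ) (hρa : ρ < 1 - μ / (d * L))
    (hr : 0 ≤ r) (hz' : ‖z' - xs‖ ≤ ρ ^ (k + 1) * r) {u : Fin d → ℝ}
    (hu : IsGreedy (classicUpdate (concM μ Lt) f B z z') (hess f z') u) :
    MemoryBound μ L Lt ρ r σ₀ xs f (k + 1) z'
      (bfgs (classicUpdate (concM μ Lt) f B z z') (hess f z') u) where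
  norm_le := hz'
  hess_le := le_bfgs (h.posDef_hess hμ z').posSemidef.nonneg (h.le_classicUpdate hμ hb.hess_le z') u
  sigma_le := by
    have hL : 0 < L := hμ.trans_le h.le_smoothness
    have hM := concM_nonneg hμ.le h.lipschitz_nonneg
    have ha : 0 < 1 - μ / (d * L) := hρ.trans_lt hρa
    have hx (j : ℕ) : 0 ≤ 4 * concM μ Lt * √L * r * ρ ^ j := by positivity
    have hβ : 4 * beta (concM μ Lt) f z z' ≤ 4 * concM μ Lt * √L * r * ρ ^ k := by
      refine hb.four_mul_beta_le h hμ (hz'.trans (mul_le_mul_of_nonneg_right ?_ hr))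
      exact pow_le_pow_of_le_one hρ (h.lt_one_of_lt_rate hμ hρa).le k.le_succ
    have hclassic : sigma (classicUpdate (concM μ Lt) f B z z') (hess f z') ≤
        Real.exp (4 * concM μ Lt * √L * r * ρ ^ k) *
          (sigma B (hess f z) + d * (4 * concM μ Lt * √L * r * ρ ^ k)) :=
      (le_sub_iff_add_le.mpr (h.sigma_classicUpdate_add_le hμ hb.hess_le z')).trans <|
        one_add_pow_four_mul_add_sub_le (h.beta_nonneg hμ.le z z')
          (sigma_nonneg (h.posDef_hess hμ z) hb.hess_le) d.cast_nonneg hβ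
    calc sigma (bfgs (classicUpdate (concM μ Lt) f B z z') (hess f z') u) (hess f z')
        ≤ (1 - μ / (d * L)) * sigma (classicUpdate (concM μ Lt) f B z z') (hess f z') :=
          sigma_bfgs_greedy_le hμ hL (h.smul_one_le_hess z') (h.hess_le_smul_one z')
            (h.le_classicUpdate hμ hb.hess_le z') hu
      _ ≤ (1 - μ / (d * L)) * (Real.exp (4 * concM μ Lt * √L * r * ρ ^ k) *
            (errBound (1 - μ / (d * L)) d σ₀ (fun j => 4 * concM μ Lt * √L * r * ρ ^ j) k +
              d * (4 * concM μ Lt * √L * r * ρ ^ k))) := by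
          gcongr
          exact hclassic.trans (by gcongr; exact hb.sigma_le)
      _ ≤ errBound (1 - μ / (d * L)) d σ₀ (fun j => 4 * concM μ Lt * √L * r * ρ ^ j) (k + 1) :=
          mul_exp_mul_errBound_add_le (x := fun j => 4 * concM μ Lt * √L * r * ρ ^ j) ha
            d.cast_nonneg hx k

end MemoryBound

variable {n : ℕ} [NeZero n] {f : Fin n → Vec d → ℝ}

theorem norm_newIterate_sub_le_of_memoryBound {k : Fin n → ℕ} {z : Fin n → Vec d}
    {B : Fin n → Mat d} (h : ∀ i, IsAdmissible μ L Lt (f i)) (hμ : 0 < μ) (hρ : 0 ≤ ρ)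
    (hρa : ρ < 1 - μ / (d * L)) (hr : 0 ≤ r) (hσ₀ : 0 ≤ σ₀)
    (hδ : L * delta d μ L Lt ρ r σ₀ + Lt / 2 * r ≤ ρ * μ)
    (hxs : ∑ i, gradient (f i) xs = 0)
    (hb : ∀ i, MemoryBound μ L Lt ρ r σ₀ xs (f i) (k i) (z i) (B i))
    {m : ℕ} (hm : ∀ i, m ≤ k i) : ‖newIterate f z B - xs‖ ≤ ρ ^ (m + 1) * r := by
  calc ‖newIterate f z B - xs‖ ≤ ρ * μ * (ρ ^ m * r) / μ :=
        norm_newIterate_sub_le hμ (fun i => ((h i).smul_one_le_hess _).trans (hb i).hess_le) hxs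
          fun i => (hb i).norm_residual_le (h i) hμ hρ hρa hr hσ₀ hδ (hm i)
    _ = ρ ^ (m + 1) * r := by field_simp; ring

namespace IsRun

variable {x : ℕ → Vec d} {z : ℕ → Fin n → Vec d} {B : ℕ → Fin n → Mat d}

theorem memoryBound (hrun : IsRun (concM μ Lt) f x z B) (h : ∀ i, IsAdmissible μ L Lt (f i))
    (hμ : 0 < μ) (hρ : 0 ≤ ρ) (hρa : ρ < 1 - μ / (d * L)) (hσ₀ : 0 ≤ σ₀)
    (hδ : L * delta d μ L Lt ρ ‖x 0 - xs‖ σ₀ + Lt / 2 * ‖x 0 - xs‖ ≤ ρ * μ)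
    (hxs : ∑ i, gradient (f i) xs = 0)
    (hσ : ∀ i, sigma (B 0 i) (hess (f i) (x 0)) ≤ σ₀) (t : ℕ) (i : Fin n) :
    MemoryBound μ L Lt ρ ‖x 0 - xs‖ σ₀ xs (f i) (updateCount n i t) (z t i) (B t i) := by
  induction t generalizing i with
  | zero => simpa [updateCount] using hrun.memoryBound_zero hσ i
  | succ t ih =>
    rcases eq_or_ne i (idx n (t + 1)) with rfl | hi
    · obtain ⟨Q, u, rfl, hu, hB⟩ := hrun.step_B t
      rw [hB, updateCount_succ_self]
      refine (ih _).update (h _) hμ hρ hρa (norm_nonneg _) ?_ hu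
      rw [hrun.step_z, hrun.step_x, updateCount_idx_succ]
      exact norm_newIterate_sub_le_of_memoryBound h hμ hρ hρa (norm_nonneg _) hσ₀ hδ hxs ih
        fun j => div_le_updateCount j t
    · rw [hrun.step_z_other t i hi, hrun.step_B_other t i hi, updateCount_succ_of_ne hi]
      exact ih i

theorem norm_succ_sub_le (hrun : IsRun (concM μ Lt) f x z B)
    (h : ∀ i, IsAdmissible μ L Lt (f i))
    (hμ : 0 < μ) (hρ : 0 ≤ ρ) (hρa : ρ < 1 - μ / (d * L)) (hσ₀ : 0 ≤ σ₀)
    (hδ : L * delta d μ L Lt ρ ‖x 0 - xs‖ σ₀ + Lt / 2 * ‖x 0 - xs‖ ≤ ρ * μ)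
    (hxs : ∑ i, gradient (f i) xs = 0)
    (hσ : ∀ i, sigma (B 0 i) (hess (f i) (x 0)) ≤ σ₀) (t : ℕ) :
    ‖x (t + 1) - xs‖ ≤ ρ ^ (t / n + 1) * ‖x 0 - xs‖ := by
  rw [hrun.step_x]
  exact norm_newIterate_sub_le_of_memoryBound h hμ hρ hρa (norm_nonneg _) hσ₀ hδ hxs
    (hrun.memoryBound h hμ hρ hρa hσ₀ hδ hxs hσ t) fun j => div_le_updateCount j t

theorem sigma_succ_le (hrun : IsRun (concM μ Lt) f x z B)
    (h : ∀ i, IsAdmissible μ L Lt (f i))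
    (hμ : 0 < μ) (hρ : 0 ≤ ρ) (hρa : ρ < 1 - μ / (d * L)) (hσ₀ : 0 ≤ σ₀)
    (hδ : L * delta d μ L Lt ρ ‖x 0 - xs‖ σ₀ + Lt / 2 * ‖x 0 - xs‖ ≤ ρ * μ)
    (hxs : ∑ i, gradient (f i) xs = 0)
    (hσ : ∀ i, sigma (B 0 i) (hess (f i) (x 0)) ≤ σ₀) (t : ℕ) :
    sigma (B (t + 1) (idx n (t + 1)))
        (hess (f (idx n (t + 1))) (z (t + 1) (idx n (t + 1)))) ≤
      (1 - μ / (d * L)) ^ (t / n + 1) * delta d μ L Lt ρ ‖x 0 - xs‖ σ₀ := by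
  have hσt := (hrun.memoryBound h hμ hρ hρa hσ₀ hδ hxs hσ (t + 1) (idx n (t + 1))).sigma_le
  rw [updateCount_succ_self, updateCount_idx_succ] at hσt
  exact hσt.trans <| errBound_le_pow_mul_delta (concM_nonneg hμ.le (h 0).lipschitz_nonneg) hρ
    ((h 0).lt_one_of_lt_rate hμ hρa) hρa (norm_nonneg _) hσ₀ _

end IsRun

end Convergence

end SIQN

theorem mainTheorem5 (d : ℕ) (hd : 0 < d) (μ L Lt ρ : ℝ) (hμ : 0 < μ)
    (hρ0 : 0 < ρ) (hρ1 : ρ < 1 - μ / (d * L)) :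
    ∃ ε : ℝ, 0 < ε ∧ ∃ σ₀ : ℝ, 0 < σ₀ ∧
      ∀ (n : ℕ) [NeZero n] (f : Fin n → SIQN.Vec d → ℝ) (xstar : SIQN.Vec d),
        (∀ i, ContDiff ℝ 2 (f i)) →
        (∀ i, SIQN.StronglyConvex μ (f i)) →
        (∀ i, SIQN.Smooth L (f i)) →
        (∀ i, SIQN.HessLipschitz Lt (f i)) →
        IsMinOn (fun y => (1 / (n : ℝ)) * ∑ i, f i y) Set.univ xstar →
        ∀ (x : ℕ → SIQN.Vec d) (z : ℕ → Fin n → SIQN.Vec d) (B : ℕ → Fin n → SIQN.Mat d),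
          SIQN.IsRun (SIQN.concM μ Lt) f x z B →
          ‖x 0 - xstar‖ ≤ ε →
          (∀ i, SIQN.sigma (B 0 i) (SIQN.hess (f i) (x 0)) ≤ σ₀) →
          (∀ t : ℕ, ‖x t - xstar‖ ≤ ρ ^ ⌈(t : ℝ) / (n : ℝ)⌉₊ * ‖x 0 - xstar‖) ∧
          (∀ t : ℕ, 1 ≤ t →
            SIQN.sigma (B t (SIQN.idx n t)) (SIQN.hess (f (SIQN.idx n t)) (z t (SIQN.idx n t)))
              ≤ (1 - μ / (d * L)) ^ ⌈(t : ℝ) / (n : ℝ)⌉₊ * SIQN.delta d μ L Lt ρ ε σ₀) := by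
  have : NeZero d := ⟨hd.ne'⟩
  obtain ⟨ε, hε, hδε⟩ := SIQN.exists_mul_delta_add_le d (L := L) (Lt := Lt) hμ hρ0
  refine ⟨ε, hε, ε, hε, fun n _ f xstar hf hsc hsm hLip hmin x z B hrun hx hσ => ?_⟩
  have h i : SIQN.IsAdmissible μ L Lt (f i) := ⟨hf i, hsc i, hsm i, hLip i⟩
  have hL : 0 ≤ L := hμ.le.trans (h 0).le_smoothness
  have hLt := (h 0).lipschitz_nonneg
  have hmono : SIQN.delta d μ L Lt ρ ‖x 0 - xstar‖ ε ≤ SIQN.delta d μ L Lt ρ ε ε :=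
    SIQN.delta_mono (SIQN.concM_nonneg hμ.le hLt) hρ0.le ((h 0).lt_one_of_lt_rate hμ hρ1) hρ1
      (norm_nonneg _) hx hε.le
  have hδ : L * SIQN.delta d μ L Lt ρ ‖x 0 - xstar‖ ε + Lt / 2 * ‖x 0 - xstar‖ ≤ ρ * μ :=
    le_trans (by gcongr) hδε
  have hxs := SIQN.sum_gradient_eq_zero (fun i => (hf i).differentiable two_ne_zero xstar) hmin
  refine ⟨fun t => ?_, fun t ht => ?_⟩
  · cases t with
    | zero => simp
    | succ t =>
      rw [SIQN.ceil_succ_div]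
      exact hrun.norm_succ_sub_le h hμ hρ0.le hρ1 hε.le hδ hxs hσ t
  · obtain ⟨t, rfl⟩ := Nat.exists_eq_add_of_le' ht
    rw [SIQN.ceil_succ_div]
    refine (hrun.sigma_succ_le h hμ hρ0.le hρ1 hε.le hδ hxs hσ t).trans ?_
    exact mul_le_mul_of_nonneg_left hmono (pow_nonneg (hρ0.trans hρ1).le _)
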